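/- Let $f:\mathbb R^d\to\mathbb R$ be differentiable and $\beta$-smooth ($\beta\ge 0$), i.e. $\|\nabla f(x)-\nabla f(y)\|\le\beta\|x-y\|$ for all $x,y$ (Euclidean norm), and suppose that $f$ attains its minimum $f^\star=\min_{w\in\mathbb R^d} f(w)$. Let $g(\cdot)$ be a stochastic gradient oracle: queried at $w\in\mathbb R^d$, it returns a random vector $g(w)$, drawn from a distribution that depends only on $w$ (measurably), with $\mathbb E[g(w)]=\nabla f(w)$ and, for some $\sigma_0,\sigma_1\ge 0$, for all $w\in\mathbb R^d$ and $t>0$, $$\Pr\bigl(\|g(w)-\mathbb E[g(w)]\|\ge t\bigr)\le 2\exp\Bigl(-\frac{t^2}{\sigma_0^2+\sigma_1^2\|\mathbb E[g(w)]\|^2}\Bigr),$$ where the right-hand side is read as $0$ if the denominator is $0$. Let $\eta,\gamma>0$, $T\ge 1$ and $w_1\in\mathbb R^d$, and consider SGD with AdaGrad stepsizes: for $1\le t\le T$, $$w_{t+1}=w_t-\eta_t g_t,\qquad \eta_t=\frac{\eta}{\sqrt{\gamma^2+\sum_{s=1}^t\|g_s\|^2}},$$ where, conditionally on $g_1,\dots,g_{t-1}$,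 the vector $g_t$ is distributed as the oracle's answer $g(w_t)$. Write $\log$ for the base-$2$ logarithm, $\ln$ for the natural logarithm and $\Delta_1=f(w_1)-f^\star$. There are universal constants $c_1,c_2>0$ such that, for any $d,f,\beta,\sigma_0,\sigma_1,\eta,\gamma,T,w_1$ and oracle as above and any $\delta\in(0,1/3)$, with probability at least $1-2\delta$ both of the following hold: (i) $$\frac1T\sum_{t=1}^T\|\nabla f(w_t)\|^2\le c_1\Bigl(\frac{2F}{\eta}+\eta\beta\Bigr)\frac{\sigma_0\sqrt{\log\frac T\delta}}{\sqrt T}+c_2\Bigl(\frac{\gamma}{\eta}\Delta_1+\Bigl(1+\sigma_1^2\log\frac1\delta\log\frac T\delta\Bigr)\Bigl(\frac{2F}{\eta}+\eta\beta\Bigr)^2+\sigma_0^2\log\frac1\delta\log\frac T\delta\Bigr)\frac1T;$$ (ii) $f(w_t)-f^\star\le F$ for all $1\le t\le T+1$, where $$F=2\Delta_1+\Bigl(9\log\frac T\delta+12C_1\Bigr)\eta\sigma_0\sqrt{\ln\frac{4T}\delta}+\Bigl(81\log^2\frac T\delta+144C_1^2\Bigr)\eta^2\beta\sigma_1^2\ln\frac{4T}\delta+\eta^2\beta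 C_1,$$ $$C_1=\log\Bigl(1+\frac{18\sigma_0^2T\ln\frac{4T}\delta+\bigl(8+72\sigma_1^2\ln\frac{4T}\delta\bigr)\bigl(\eta^2\beta^2T^3+\beta\Delta_1T\bigr)}{\gamma^2}\Bigr).$$ -/

import Mathlib

open MeasureTheory ProbabilityTheory

/-- `f : ℝᵈ → ℝ` is `β`-smooth: differentiable, with `β`-Lipschitz gradient (Euclidean norm). -/
structure IsBetaSmooth {d : ℕ} (β : ℝ) (f : EuclideanSpace ℝ (Fin d) → ℝ) : Prop where
  differentiable : Differentiable ℝ f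
  lipschitz : ∀ x y, ‖gradient f x - gradient f y‖ ≤ β * ‖x - y‖

/-- An unbiased stochastic gradient oracle for `f`. The oracle is a Markov kernel: `κ w` is the
law of the random vector `g(w)` that is returned when the point `w` is queried. -/
structure IsUnbiasedOracle {d : ℕ} (f : EuclideanSpace ℝ (Fin d) → ℝ)
    (κ : Kernel (EuclideanSpace ℝ (Fin d)) (EuclideanSpace ℝ (Fin d))) : Prop where
  markov : IsMarkovKernel κ
  integrable : ∀ w, Integrable (fun x => x) (κ w)
  mean : ∀ w, ∫ x, x ∂(κ w) = gradient f w

/-- The tail `2 exp (-t² / v)` for `t > 0` and `v ≥ 0`, read as its limit `0` when `v = 0`. -/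
noncomputable def subGaussianTail (v t : ℝ) : ℝ :=
  if v = 0 then 0 else 2 * Real.exp (-(t ^ 2 / v))

/-- Sub-Gaussian affine-variance noise: for every query point `w` and every `t > 0`,
`P(‖g(w) - E g(w)‖ ≥ t) ≤ 2 exp (-t² / (σ₀² + σ₁² ‖E g(w)‖²))`. -/
def IsSubGaussianOracle {d : ℕ} (σ₀ σ₁ : ℝ)
    (κ : Kernel (EuclideanSpace ℝ (Fin d)) (EuclideanSpace ℝ (Fin d))) : Prop :=
  ∀ w : EuclideanSpace ℝ (Fin d), ∀ t : ℝ, 0 < t →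
    (κ w).real {x | t ≤ ‖x - ∫ y, y ∂(κ w)‖} ≤
      subGaussianTail (σ₀ ^ 2 + σ₁ ^ 2 * ‖∫ y, y ∂(κ w)‖ ^ 2) t

/-- The AdaGrad stepsize `η_t = η / √(γ² + ∑_{s=1}^t ‖g_s‖²)`. -/
noncomputable def adaStep {d : ℕ} (η γ : ℝ) (g : ℕ → EuclideanSpace ℝ (Fin d)) (t : ℕ) : ℝ :=
  η / Real.sqrt (γ ^ 2 + ∑ s ∈ Finset.Icc 1 t, ‖g s‖ ^ 2)

/-- The σ-algebra generated by `g_1, …, g_{t-1}`. -/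
abbrev pastSigma {d : ℕ} {Ω : Type*} (g : ℕ → Ω → EuclideanSpace ℝ (Fin d)) (t : ℕ) :
    MeasurableSpace Ω :=
  ⨆ s ∈ Finset.Ico 1 t, MeasurableSpace.comap (g s) inferInstance

/-- `w_1, …, w_{T+1}` and `g_1, …, g_T` are the iterates and the stochastic gradients of a
`T`-step run of SGD with AdaGrad stepsizes, started at `w₁`, with the oracle `κ`: conditionally on
`g_1, …, g_{t-1}`, the law of `g_t` is that of the oracle's answer to the query `w_t`. -/
structure IsAdaSGDRun {d : ℕ} {Ω : Type*} [MeasurableSpace Ω] (μ : Measure Ω)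
    (κ : Kernel (EuclideanSpace ℝ (Fin d)) (EuclideanSpace ℝ (Fin d)))
    (η γ : ℝ) (T : ℕ) (w₁ : EuclideanSpace ℝ (Fin d))
    (w g : ℕ → Ω → EuclideanSpace ℝ (Fin d)) : Prop where
  init : ∀ ω, w 1 ω = w₁
  step : ∀ t ∈ Finset.Icc 1 T, ∀ ω,
    w (t + 1) ω = w t ω - adaStep η γ (fun s => g s ω) t • g t ω
  measurable : ∀ t ∈ Finset.Icc 1 T, Measurable (g t)
  query : ∀ t ∈ Finset.Icc 1 T, ∀ B : Set (EuclideanSpace ℝ (Fin d)), MeasurableSet B →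
    μ[(g t ⁻¹' B).indicator (fun _ => (1 : ℝ)) | pastSigma g t]
      =ᵐ[μ] fun ω => (κ (w t ω)).real B

/-- The logarithmic factor `C₁`; `Real.logb 2` is the base `2` logarithm, `Real.log` is `ln`. -/
noncomputable def boundC₁ (β σ₀ σ₁ η γ δ Δ₁ : ℝ) (T : ℕ) : ℝ :=
  Real.logb 2 (1 +
    (18 * σ₀ ^ 2 * T * Real.log (4 * T / δ)
      + (8 + 72 * σ₁ ^ 2 * Real.log (4 * T / δ))
        * (η ^ 2 * β ^ 2 * (T : ℝ) ^ 3 + β * Δ₁ * T)) / γ ^ 2)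

/-- The bound `F` on the optimality gap along the trajectory. -/
noncomputable def boundF (β σ₀ σ₁ η γ δ Δ₁ : ℝ) (T : ℕ) : ℝ :=
  2 * Δ₁
    + (9 * Real.logb 2 (T / δ) + 12 * boundC₁ β σ₀ σ₁ η γ δ Δ₁ T)
        * η * σ₀ * Real.sqrt (Real.log (4 * T / δ))
    + (81 * Real.logb 2 (T / δ) ^ 2 + 144 * boundC₁ β σ₀ σ₁ η γ δ Δ₁ T ^ 2)
        * η ^ 2 * β * σ₁ ^ 2 * Real.log (4 * T / δ)
    + η ^ 2 * β * boundC₁ β σ₀ σ₁ η γ δ Δ₁ T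

/-!
Write `ξ_t = g_t - ∇f(w_t)`, `Δ_t = f(w_t) - f*`, `G_t = γ² + ∑_{s ≤ t} ‖g_s‖²`,
`σ_t² = σ₀² + σ₁² ‖∇f(w_t)‖²` and `ℓ = ln (4 T / δ)`.

The noise is handled without truncation. A sub-Gaussian tail and the vanishing mean give
`E exp ⟨u, ξ_t⟩ ≤ exp (4 ‖u‖² σ_t²)` conditionally on the past
(`lintegral_exp_inner_le_of_tail`), so `exp (∑ (⟨u_s, ξ_s⟩ - 4 ‖u_s‖² σ_s²))` has expectation at
most `1` for every predictable sequence `u` (`IsAdaSGDRun.lintegral_exp_sum_le`), and Markov's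
inequality bounds the exponent. Three events make up the exceptional set: the event that
`‖ξ_t‖² > ℓ σ_t²` for some `t` (probability at most `δ / 2`), a deviation of the martingale with
weights `gapWeight` at some time (at most `δ`, by a union bound over `t ≤ T`), and a deviation of
the martingale with weights `avgWeight` at time `T` (at most `δ / 2`). Both weights carry the
indicator of `Δ_t ≤ F`, so the choice of their scale needs no prior control of the trajectory.

Outside these events the argument is deterministic. For the optimality gap, the AdaGrad stepsize
`η_t` is exchanged for the predictable `η / √(G_{t-1} + ‖∇f(w_t)‖² + ℓ σ_t²)` (`decorStep`). By
`neg_step_inner_le` the exchange costs half of the descent and a multiple of `‖g_t‖² / G_t`, whose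
sum is at most `ln (G_T / γ²)`; as the steps have length at most `η`, this is at most `C₁ ln 2`. The
variance of the martingale is absorbed by the other half of the descent. Induction on `t` yields
`Δ_t ≤ F` as long as `F` dominates an expression that itself grows like `√F`, and `boundF_closes`
checks this by the inequality of arithmetic and geometric means.

For the average of the squared gradients, the descent inequality is divided by `η_t` and summed by
parts, which with `Δ_t ≤ F` gives
`∑ ⟨∇f(w_t), g_t⟩ ≤ γ Δ₁ / η + (F / η + η β) (√G_T - γ)` (`sum_inner_le`). The noise bound
controls `G_T` by `T` and `∑ ‖∇f(w_t)‖²`, the second martingale controls `∑ ⟨∇f(w_t), ξ_t⟩`, and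
Young's inequality finishes the proof.
-/

/-! ### Smooth functions -/

namespace IsBetaSmooth

variable {d : ℕ} {β fstar : ℝ} {f : EuclideanSpace ℝ (Fin d) → ℝ}

/-- The quadratic upper bound of a smooth function. -/
lemma descent (h : IsBetaSmooth β f) (x y : EuclideanSpace ℝ (Fin d)) :
    f y ≤ f x + inner ℝ (gradient f x) (y - x) + β / 2 * ‖y - x‖ ^ 2 := by
  set v := y - x with hv
  let φ : ℝ → ℝ := fun t => f (x + t • v) - t * inner ℝ (gradient f x) v - β / 2 * ‖v‖ ^ 2 * t ^ 2
  have hder : ∀ t, HasDerivAt φ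
      (inner ℝ (gradient f (x + t • v)) v - inner ℝ (gradient f x) v - β * ‖v‖ ^ 2 * t) t := by
    intro t
    have h1 : HasDerivAt (fun t : ℝ => x + t • v) v t := by
      simpa using ((hasDerivAt_id t).smul_const v).const_add x
    have h2 := (h.differentiable (x + t • v)).hasGradientAt.hasFDerivAt.comp_hasDerivAt t h1
    have h3 := (h2.sub ((hasDerivAt_id t).mul_const (inner ℝ (gradient f x) v))).sub
      ((hasDerivAt_pow 2 t).const_mul (β / 2 * ‖v‖ ^ 2))
    refine h3.congr_deriv ?_
    simp only [InnerProductSpace.toDual_apply_apply]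
    simp
    ring
  have hanti : AntitoneOn φ (Set.Icc 0 1) := by
    refine antitoneOn_of_deriv_nonpos (convex_Icc 0 1)
      (fun t _ => (hder t).continuousAt.continuousWithinAt)
      (fun t _ => (hder t).differentiableAt.differentiableWithinAt) fun t ht => ?_
    rw [(hder t).deriv]
    rw [interior_Icc] at ht
    have h1 : inner ℝ (gradient f (x + t • v) - gradient f x) v
        ≤ ‖gradient f (x + t • v) - gradient f x‖ * ‖v‖ := real_inner_le_norm _ _
    have h2 := h.lipschitz (x + t • v) x
    rw [add_sub_cancel_left, norm_smul, Real.norm_of_nonneg ht.1.le] at h2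
    rw [inner_sub_left] at h1
    nlinarith [mul_le_mul_of_nonneg_right h2 (norm_nonneg v)]
  have h01 := hanti (Set.left_mem_Icc.2 zero_le_one) (Set.right_mem_Icc.2 zero_le_one) zero_le_one
  simp only [φ, one_smul, zero_smul, add_zero, hv, add_sub_cancel] at h01
  rw [hv]
  linarith

lemma norm_gradient_sq_le (h : IsBetaSmooth β f) (hβ : 0 ≤ β) (hmin : ∀ z, fstar ≤ f z)
    (x : EuclideanSpace ℝ (Fin d)) : ‖gradient f x‖ ^ 2 ≤ 2 * β * (f x - fstar) := by
  have key : ∀ s : ℝ, s * ‖gradient f x‖ ^ 2 - β / 2 * s ^ 2 * ‖gradient f x‖ ^ 2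
      ≤ f x - fstar := by
    intro s
    have h1 := h.descent x (x - s • gradient f x)
    have h2 := hmin (x - s • gradient f x)
    rw [sub_sub_cancel_left, inner_neg_right, inner_smul_right, real_inner_self_eq_norm_sq,
      norm_neg, norm_smul, mul_pow, Real.norm_eq_abs, sq_abs] at h1
    linarith
  rcases hβ.eq_or_lt with rfl | hβ
  · -- the gap bounds `s ‖∇f(x)‖²` for arbitrarily large `s`
    by_contra hne
    simp only [mul_zero, zero_mul, not_le] at hne
    have := key ((f x - fstar + 1) / ‖gradient f x‖ ^ 2)
    rw [div_mul_cancel₀ _ hne.ne'] at this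
    linarith
  · have := key (1 / β)
    field_simp at this
    nlinarith

lemma continuous_gradient (h : IsBetaSmooth β f) : Continuous (gradient f) := by
  refine (LipschitzWith.of_dist_le_mul (K := β.toNNReal) fun x y => ?_).continuous
  rw [dist_eq_norm, dist_eq_norm]
  exact (h.lipschitz x y).trans
    (mul_le_mul_of_nonneg_right (Real.le_coe_toNNReal β) (norm_nonneg _))

end IsBetaSmooth

/-! ### The accumulated squared gradients -/

/-- `γ² + ∑_{s=1}^t ‖g_s‖²`, so that the AdaGrad stepsize is `η / √(adaAccum γ g t)`. -/
noncomputable def adaAccum {E : Type*} [Norm E] (γ : ℝ) (g : ℕ → E) (t : ℕ) : ℝ :=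
  γ ^ 2 + ∑ s ∈ Finset.Icc 1 t, ‖g s‖ ^ 2

section Accum

variable {E : Type*} [NormedAddCommGroup E] {γ : ℝ} {g : ℕ → E}

lemma adaAccum_zero : adaAccum γ g 0 = γ ^ 2 := by simp [adaAccum]

lemma adaAccum_succ (t : ℕ) : adaAccum γ g (t + 1) = adaAccum γ g t + ‖g (t + 1)‖ ^ 2 := by
  rw [adaAccum, adaAccum, Finset.sum_Icc_succ_top (by omega)]
  ring

lemma adaAccum_pos (hγ : 0 < γ) (t : ℕ) : 0 < adaAccum γ g t := by
  unfold adaAccum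
  positivity

/-- The normalized squared gradients telescope against the logarithm of their accumulated sum. -/
lemma sum_sq_div_adaAccum_le_log (hγ : 0 < γ) (t : ℕ) :
    ∑ s ∈ Finset.Icc 1 t, ‖g s‖ ^ 2 / adaAccum γ g s ≤ Real.log (adaAccum γ g t / γ ^ 2) := by
  induction t with
  | zero => simp [adaAccum_zero, hγ.ne']
  | succ t ih =>
    rw [Finset.sum_Icc_succ_top (by omega)]
    have h0 := adaAccum_pos (g := g) hγ t
    have h1 := adaAccum_pos (g := g) hγ (t + 1)
    have h2 := Real.log_le_sub_one_of_pos (div_pos h0 h1)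
    have hs := adaAccum_succ (γ := γ) (g := g) t
    have h3 : adaAccum γ g t / adaAccum γ g (t + 1) - 1
        = -(‖g (t + 1)‖ ^ 2 / adaAccum γ g (t + 1)) := by
      field_simp
      linarith
    rw [Real.log_div h0.ne' h1.ne', h3] at h2
    rw [Real.log_div h0.ne' (by positivity)] at ih
    rw [Real.log_div h1.ne' (by positivity)]
    linarith

end Accum

/-- One AdaGrad step compared with a step of predictable size `η / √(A + ‖G‖² + v²)`: here `G` is
the true gradient, `x` the stochastic one, `v` a bound on the noise and `A` the sum accumulated
before the step. The price of the exchange is half of the descent plus a multiple of the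
normalized square `‖x‖² / (A + ‖x‖²)`. -/
lemma neg_step_inner_le {E : Type*} [NormedAddCommGroup E] [InnerProductSpace ℝ E]
    {A η v : ℝ} {G x : E} (hA : 0 < A) (hη : 0 ≤ η) (hv : 0 ≤ v) (hx : ‖x - G‖ ≤ v) :
    -(η / √(A + ‖x‖ ^ 2) * inner ℝ G x) ≤
      -(1 / 2 * (η / √(A + ‖G‖ ^ 2 + v ^ 2) * ‖G‖ ^ 2))
        - η / √(A + ‖G‖ ^ 2 + v ^ 2) * inner ℝ G (x - G)
        + 9 / 2 * η * v * (‖x‖ ^ 2 / (A + ‖x‖ ^ 2)) := by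
  have hp2 : √(A + ‖x‖ ^ 2) ^ 2 = A + ‖x‖ ^ 2 := Real.sq_sqrt (by positivity)
  have hq2 : √(A + ‖G‖ ^ 2 + v ^ 2) ^ 2 = A + ‖G‖ ^ 2 + v ^ 2 := Real.sq_sqrt (by positivity)
  have hp : 0 < √(A + ‖x‖ ^ 2) := Real.sqrt_pos.2 (by positivity)
  have hq : 0 < √(A + ‖G‖ ^ 2 + v ^ 2) := Real.sqrt_pos.2 (by positivity)
  set p := √(A + ‖x‖ ^ 2)
  set q := √(A + ‖G‖ ^ 2 + v ^ 2)
  rw [← hp2]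
  have hGq : ‖G‖ ≤ q := abs_le_of_sq_le_sq' (by nlinarith [sq_nonneg v]) hq.le |>.2
  have hvq : v ≤ q := abs_le_of_sq_le_sq' (by nlinarith [sq_nonneg ‖G‖]) hq.le |>.2
  have hxsq : ‖x‖ ^ 2 = ‖G‖ ^ 2 + 2 * inner ℝ G (x - G) + ‖x - G‖ ^ 2 := by
    rw [← norm_add_sq_real, add_sub_cancel]
  have hin : |inner ℝ G (x - G)| ≤ q * v := (abs_real_inner_le_norm _ _).trans
    (mul_le_mul hGq hx (norm_nonneg _) hq.le)
  have hnn : ‖x - G‖ ^ 2 ≤ v ^ 2 := pow_le_pow_left₀ (norm_nonneg _) hx 2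
  have hvv : v ^ 2 ≤ q * v := by nlinarith
  obtain ⟨hin1, hin2⟩ := abs_le.1 hin
  have hpq : |p - q| ≤ 3 * v := by
    have e : (p - q) * (p + q) = 2 * inner ℝ G (x - G) + ‖x - G‖ ^ 2 - v ^ 2 := by
      linear_combination hp2 - hq2 + hxsq
    refine abs_le.2 ⟨?_, ?_⟩
    · by_contra hc
      push Not at hc
      nlinarith [sq_nonneg ‖x - G‖, mul_pos (sub_pos.2 hc) (add_pos hp hq), mul_nonneg hv hp.le]
    · by_contra hc
      push Not at hc
      nlinarith [mul_pos (sub_pos.2 hc) (add_pos hp hq), mul_nonneg hv hp.le]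
  have hdec : inner ℝ G x = ‖G‖ ^ 2 + inner ℝ G (x - G) := by
    rw [inner_sub_right, real_inner_self_eq_norm_sq]
    ring
  have hGx : |inner ℝ G x| ≤ ‖G‖ * ‖x‖ := abs_real_inner_le_norm _ _
  have hdiff : (1 / q - 1 / p) * inner ℝ G x ≤ 3 * v / (p * q) * (‖G‖ * ‖x‖) := by
    have e : 1 / q - 1 / p = (p - q) / (p * q) := by field_simp
    rw [e]
    refine (le_abs_self _).trans ?_
    rw [abs_mul, abs_div, abs_of_pos (mul_pos hp hq)]
    gcongr
  have hamgm : 3 * v / (p * q) * (‖G‖ * ‖x‖) ≤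
      1 / 2 * (‖G‖ ^ 2 / q) + 9 / 2 * v * (‖x‖ ^ 2 / p ^ 2) := by
    have h1 : v ^ 2 / q ≤ v := by
      rw [div_le_iff₀ hq]
      nlinarith
    have h2 : 3 * v / (p * q) * (‖G‖ * ‖x‖) ≤
        1 / 2 * (‖G‖ ^ 2 / q) + 9 / 2 * (v ^ 2 / q) * (‖x‖ ^ 2 / p ^ 2) := by
      have : 1 / 2 * (‖G‖ ^ 2 / q) + 9 / 2 * (v ^ 2 / q) * (‖x‖ ^ 2 / p ^ 2)
          - 3 * v / (p * q) * (‖G‖ * ‖x‖) = (‖G‖ - 3 * v * (‖x‖ / p)) ^ 2 / (2 * q) := by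
        field_simp
        ring
      have h3 : 0 ≤ (‖G‖ - 3 * v * (‖x‖ / p)) ^ 2 / (2 * q) := by positivity
      linarith
    refine h2.trans ?_
    gcongr
  have := mul_le_mul_of_nonneg_left (hdiff.trans hamgm) hη
  have e1 : η * ((1 / q - 1 / p) * inner ℝ G x) =
      η / q * ‖G‖ ^ 2 + η / q * inner ℝ G (x - G) - η / p * inner ℝ G x := by
    rw [hdec]
    ring
  have e2 : η * (1 / 2 * (‖G‖ ^ 2 / q) + 9 / 2 * v * (‖x‖ ^ 2 / p ^ 2)) =
      1 / 2 * (η / q * ‖G‖ ^ 2) + 9 / 2 * η * v * (‖x‖ ^ 2 / p ^ 2) := by ring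
  rw [e1, e2] at this
  linarith

/-! ### Deterministic estimates along a trajectory -/

/-- The variance proxy `σ₀² + σ₁² ‖∇f(x)‖²` of the noise at the point `x`. -/
noncomputable def noiseVar {d : ℕ} (f : EuclideanSpace ℝ (Fin d) → ℝ) (σ₀ σ₁ : ℝ)
    (x : EuclideanSpace ℝ (Fin d)) : ℝ :=
  σ₀ ^ 2 + σ₁ ^ 2 * ‖gradient f x‖ ^ 2

/-- The decorrelated stepsize: the unknown `‖g_t‖²` in the AdaGrad stepsize is replaced by its proxy
`‖∇f(w_t)‖² + ℓ (σ₀² + σ₁² ‖∇f(w_t)‖²)`, which is known before `g_t` is drawn. -/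
noncomputable def decorStep {d : ℕ} (f : EuclideanSpace ℝ (Fin d) → ℝ) (σ₀ σ₁ η γ ℓ : ℝ)
    (w g : ℕ → EuclideanSpace ℝ (Fin d)) (t : ℕ) : ℝ :=
  η / √(adaAccum γ g (t - 1) + ‖gradient f (w t)‖ ^ 2 + ℓ * noiseVar f σ₀ σ₁ (w t))

section Path

variable {d : ℕ} {f : EuclideanSpace ℝ (Fin d) → ℝ} {β σ₀ σ₁ η γ ℓ fstar F : ℝ} {T : ℕ}
  {w g : ℕ → EuclideanSpace ℝ (Fin d)}

lemma noiseVar_nonneg (x : EuclideanSpace ℝ (Fin d)) : 0 ≤ noiseVar f σ₀ σ₁ x := by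
  unfold noiseVar
  positivity

lemma decorStep_nonneg (hη : 0 ≤ η) (t : ℕ) : 0 ≤ decorStep f σ₀ σ₁ η γ ℓ w g t := by
  unfold decorStep
  positivity

lemma decorStep_mul_sqrt_le (hη : 0 ≤ η) (t : ℕ) :
    decorStep f σ₀ σ₁ η γ ℓ w g t * √(ℓ * noiseVar f σ₀ σ₁ (w t)) ≤ η := by
  unfold decorStep
  rw [div_mul_eq_mul_div]
  refine div_le_of_le_mul₀ (Real.sqrt_nonneg _) hη (mul_le_mul_of_nonneg_left ?_ hη)
  refine Real.sqrt_le_sqrt ?_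
  have : 0 ≤ adaAccum γ g (t - 1) := by
    unfold adaAccum
    positivity
  nlinarith [sq_nonneg ‖gradient f (w t)‖]

lemma norm_adaStep_smul_le (hη : 0 ≤ η) {t : ℕ} (ht : 1 ≤ t) :
    ‖adaStep η γ g t • g t‖ ≤ η := by
  rw [norm_smul, adaStep, Real.norm_of_nonneg (by positivity), div_mul_eq_mul_div]
  refine div_le_of_le_mul₀ (Real.sqrt_nonneg _) hη (mul_le_mul_of_nonneg_left ?_ hη)
  refine Real.le_sqrt_of_sq_le ?_
  have := Finset.single_le_sum (f := fun s => ‖g s‖ ^ 2) (fun s _ => sq_nonneg _)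
    (Finset.mem_Icc.2 ⟨ht, le_rfl⟩)
  nlinarith [sq_nonneg γ]

/-- Each step has length at most `η`, so the gradient grows at most linearly. -/
lemma norm_gradient_iterate_le (hf : IsBetaSmooth β f) (hβ : 0 ≤ β) (hη : 0 ≤ η)
    (hstep : ∀ t ∈ Finset.Icc 1 T, w (t + 1) = w t - adaStep η γ g t • g t)
    (t : ℕ) (ht : t ≤ T) :
    ‖gradient f (w (t + 1))‖ ≤ ‖gradient f (w 1)‖ + β * η * t := by
  induction t with
  | zero => simp
  | succ t ih =>
    have h1 := ih (by omega)
    have h2 := hf.lipschitz (w (t + 1 + 1)) (w (t + 1))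
    rw [hstep (t + 1) (Finset.mem_Icc.2 ⟨by omega, ht⟩), sub_sub_cancel_left, norm_neg] at h2
    have h3 := norm_adaStep_smul_le (γ := γ) (g := g) hη (t := t + 1) (by omega)
    rw [← hstep (t + 1) (Finset.mem_Icc.2 ⟨by omega, ht⟩)] at h2
    have h4 := norm_le_norm_add_norm_sub' (gradient f (w (t + 1 + 1))) (gradient f (w (t + 1)))
    have h5 := mul_le_mul_of_nonneg_left h3 hβ
    push_cast
    linarith

/-- The a priori bound on the accumulated squared gradients when the noise obeys its
high-probability bound. -/
lemma adaAccum_le (hf : IsBetaSmooth β f) (hβ : 0 ≤ β) (hη : 0 ≤ η) (hℓ : 0 ≤ ℓ)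
    (hmin : ∀ z, fstar ≤ f z)
    (hstep : ∀ t ∈ Finset.Icc 1 T, w (t + 1) = w t - adaStep η γ g t • g t)
    (hnoise : ∀ s ∈ Finset.Icc 1 T,
      ‖g s - gradient f (w s)‖ ^ 2 ≤ ℓ * noiseVar f σ₀ σ₁ (w s)) :
    adaAccum γ g T ≤ γ ^ 2 + (2 * ℓ * σ₀ ^ 2 * T + (8 + 8 * ℓ * σ₁ ^ 2) *
      (η ^ 2 * β ^ 2 * (T : ℝ) ^ 3 + β * (f (w 1) - fstar) * T)) := by
  have hterm : ∀ s ∈ Finset.Icc 1 T, ‖g s‖ ^ 2 ≤ 2 * ℓ * σ₀ ^ 2 + (8 + 8 * ℓ * σ₁ ^ 2) *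
      (η ^ 2 * β ^ 2 * (T : ℝ) ^ 2 + β * (f (w 1) - fstar)) := by
    intro s hs
    obtain ⟨h1, h2⟩ := Finset.mem_Icc.1 hs
    obtain ⟨t, rfl⟩ : ∃ t, s = t + 1 := ⟨s - 1, by omega⟩
    have ha := norm_gradient_iterate_le hf hβ hη hstep t (by omega)
    have htT : β * η * (t : ℝ) ≤ β * η * T := by
      have : (t : ℝ) ≤ T := by exact_mod_cast (by omega : t ≤ T)
      gcongr
    have h0 := hf.norm_gradient_sq_le hβ hmin (w 1)
    have hn := hnoise _ hs
    have hasq : ‖gradient f (w (t + 1))‖ ^ 2 ≤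
        4 * (η ^ 2 * β ^ 2 * (T : ℝ) ^ 2 + β * (f (w 1) - fstar)) := by
      have h3 : ‖gradient f (w (t + 1))‖ ^ 2 ≤ (‖gradient f (w 1)‖ + β * η * T) ^ 2 :=
        pow_le_pow_left₀ (norm_nonneg _) (by linarith) 2
      nlinarith [sq_nonneg (‖gradient f (w 1)‖ - β * η * T), sq_nonneg (β * η * T)]
    have hg : ‖g (t + 1)‖ ^ 2 ≤ 2 * ‖gradient f (w (t + 1))‖ ^ 2
        + 2 * ‖g (t + 1) - gradient f (w (t + 1))‖ ^ 2 := by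
      have := norm_le_norm_add_norm_sub' (g (t + 1)) (gradient f (w (t + 1)))
      nlinarith [sq_nonneg (‖gradient f (w (t + 1))‖ - ‖g (t + 1) - gradient f (w (t + 1))‖),
        norm_nonneg (g (t + 1))]
    unfold noiseVar at hn
    have h6 : (2 + 2 * ℓ * σ₁ ^ 2) * ‖gradient f (w (t + 1))‖ ^ 2 ≤ (2 + 2 * ℓ * σ₁ ^ 2) *
        (4 * (η ^ 2 * β ^ 2 * (T : ℝ) ^ 2 + β * (f (w 1) - fstar))) :=
      mul_le_mul_of_nonneg_left hasq (by positivity)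
    linarith
  have := Finset.sum_le_sum hterm
  rw [Finset.sum_const, Nat.card_Icc, Nat.add_sub_cancel, nsmul_eq_mul] at this
  unfold adaAccum
  linarith

lemma adaStep_sq_mul (hγ : 0 < γ) (t : ℕ) :
    adaStep η γ g t ^ 2 * ‖g t‖ ^ 2 = η ^ 2 * (‖g t‖ ^ 2 / adaAccum γ g t) := by
  have : adaStep η γ g t = η / √(adaAccum γ g t) := rfl
  rw [this, div_pow, Real.sq_sqrt (adaAccum_pos hγ t).le]
  ring

lemma descent_iterate (hf : IsBetaSmooth β f) (hγ : 0 < γ)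
    (hstep : ∀ t ∈ Finset.Icc 1 T, w (t + 1) = w t - adaStep η γ g t • g t)
    {t : ℕ} (ht : t ∈ Finset.Icc 1 T) :
    f (w (t + 1)) ≤ f (w t) - adaStep η γ g t * inner ℝ (gradient f (w t)) (g t)
      + β / 2 * η ^ 2 * (‖g t‖ ^ 2 / adaAccum γ g t) := by
  have h := hf.descent (w t) (w (t + 1))
  rw [hstep t ht, sub_sub_cancel_left, inner_neg_right, inner_smul_right, norm_neg, norm_smul,
    mul_pow, Real.norm_eq_abs, sq_abs, adaStep_sq_mul hγ] at h
  rw [hstep t ht]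
  linarith

/-- Descent in terms of the decorrelated stepsize. -/
lemma descent_decorStep (hf : IsBetaSmooth β f) (hη : 0 ≤ η) (hγ : 0 < γ) (hℓ : 0 ≤ ℓ)
    (hstep : ∀ t ∈ Finset.Icc 1 T, w (t + 1) = w t - adaStep η γ g t • g t)
    {t : ℕ} (ht : t ∈ Finset.Icc 1 T)
    (hnoise : ‖g t - gradient f (w t)‖ ^ 2 ≤ ℓ * noiseVar f σ₀ σ₁ (w t)) :
    f (w (t + 1)) ≤ f (w t)
      - 1 / 2 * (decorStep f σ₀ σ₁ η γ ℓ w g t * ‖gradient f (w t)‖ ^ 2)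
      - decorStep f σ₀ σ₁ η γ ℓ w g t * inner ℝ (gradient f (w t)) (g t - gradient f (w t))
      + (9 / 2 * η * √(ℓ * noiseVar f σ₀ σ₁ (w t)) + β / 2 * η ^ 2)
          * (‖g t‖ ^ 2 / adaAccum γ g t) := by
  obtain ⟨s, rfl⟩ : ∃ s, t = s + 1 := ⟨t - 1, by have := (Finset.mem_Icc.1 ht).1; omega⟩
  have h1 := descent_iterate hf hγ hstep ht
  have hv : 0 ≤ ℓ * noiseVar f σ₀ σ₁ (w (s + 1)) := mul_nonneg hℓ (noiseVar_nonneg _)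
  have h2 := neg_step_inner_le (x := g (s + 1)) (G := gradient f (w (s + 1)))
    (adaAccum_pos (g := g) hγ s) hη (Real.sqrt_nonneg _) (Real.le_sqrt_of_sq_le hnoise)
  rw [Real.sq_sqrt hv, ← adaAccum_succ] at h2
  have e1 : adaStep η γ g (s + 1) = η / √(adaAccum γ g (s + 1)) := rfl
  have e2 : decorStep f σ₀ σ₁ η γ ℓ w g (s + 1) = η / √(adaAccum γ g s +
    ‖gradient f (w (s + 1))‖ ^ 2 + ℓ * noiseVar f σ₀ σ₁ (w (s + 1))) := rfl
  rw [← e1, ← e2] at h2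
  linarith

/-- The weights `u_t` of the noise in the martingale that controls the optimality gap. The indicator
keeps the weights bounded without any assumption on the trajectory. -/
noncomputable def gapWeight (f : EuclideanSpace ℝ (Fin d) → ℝ) (σ₀ σ₁ η γ ℓ fstar F c : ℝ)
    (w g : ℕ → EuclideanSpace ℝ (Fin d)) (t : ℕ) : EuclideanSpace ℝ (Fin d) :=
  if f (w t) - fstar ≤ F then (-(c * decorStep f σ₀ σ₁ η γ ℓ w g t)) • gradient f (w t) else 0

/-- If the noise obeys its high-probability bound and the martingale with weights `gapWeight` stays
below `x`, then the optimality gap stays below any `F` that solves the inequality `hF`. -/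
lemma gap_le_of_martingale_le {K x Λ : ℝ} (hf : IsBetaSmooth β f) (hβ : 0 ≤ β) (hη : 0 < η)
    (hγ : 0 < γ) (hℓ : 1 ≤ ℓ)
    (hstep : ∀ t ∈ Finset.Icc 1 T, w (t + 1) = w t - adaStep η γ g t • g t)
    (hnoise : ∀ s ∈ Finset.Icc 1 T,
      ‖g s - gradient f (w s)‖ ^ 2 ≤ ℓ * noiseVar f σ₀ σ₁ (w s))
    (hΛ : ∀ t ≤ T, ∑ s ∈ Finset.Icc 1 t, ‖g s‖ ^ 2 / adaAccum γ g s ≤ Λ)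
    (hx : 0 ≤ x) (hK : 0 ≤ K) (hvar : ∀ z, f z - fstar ≤ F → noiseVar f σ₀ σ₁ z ≤ K ^ 2)
    (hmart : ∀ t ∈ Finset.Icc 1 T, ∑ s ∈ Finset.Icc 1 t,
      (inner ℝ (gapWeight f σ₀ σ₁ η γ ℓ fstar F (1 / (8 * η * K)) w g s) (g s - gradient f (w s))
        - 4 * ‖gapWeight f σ₀ σ₁ η γ ℓ fstar F (1 / (8 * η * K)) w g s‖ ^ 2
          * noiseVar f σ₀ σ₁ (w s)) ≤ x)
    (hF : f (w 1) - fstar + 8 * η * K * x + 9 / 2 * η * (√ℓ * K) * Λ + β / 2 * η ^ 2 * Λ ≤ F) :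
    ∀ t ∈ Finset.Icc 1 (T + 1), f (w t) - fstar ≤ F := by
  have hΛ0 : 0 ≤ Λ := by simpa using hΛ 0 (Nat.zero_le _)
  intro t
  induction t using Nat.strong_induction_on with
  | _ t ih =>
  intro ht
  obtain ⟨n, rfl⟩ : ∃ n, t = n + 1 := ⟨t - 1, by have := (Finset.mem_Icc.1 ht).1; omega⟩
  have hn : n ≤ T := by
    have := (Finset.mem_Icc.1 ht).2
    omega
  have hgap : ∀ s ∈ Finset.Icc 1 n, f (w s) - fstar ≤ F := fun s hs => by
    have := Finset.mem_Icc.1 hs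
    exact ih s (by omega) (Finset.mem_Icc.2 (by omega))
  have hsT : ∀ s ∈ Finset.Icc 1 n, s ∈ Finset.Icc 1 T := fun s hs => by
    have := Finset.mem_Icc.1 hs
    exact Finset.mem_Icc.2 (by omega)
  set e := decorStep f σ₀ σ₁ η γ ℓ w g with he
  set N := fun s => inner ℝ (gradient f (w s)) (g s - gradient f (w s)) with hN
  have hsum : ∀ m ≤ n, f (w (m + 1)) ≤ f (w 1)
      + ∑ s ∈ Finset.Icc 1 m, (-(e s * N s) - 1 / 2 * (e s * ‖gradient f (w s)‖ ^ 2))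
      + (9 / 2 * η * (√ℓ * K) + β / 2 * η ^ 2)
        * ∑ s ∈ Finset.Icc 1 m, ‖g s‖ ^ 2 / adaAccum γ g s := by
    intro m hm
    induction m with
    | zero => simp
    | succ m ihm =>
      have hmem : m + 1 ∈ Finset.Icc 1 n := Finset.mem_Icc.2 ⟨by omega, hm⟩
      have h1 := ihm (by omega)
      have h2 := descent_decorStep hf hη.le hγ (zero_le_one.trans hℓ) hstep (hsT _ hmem)
        (hnoise _ (hsT _ hmem))
      rw [Finset.sum_Icc_succ_top (by omega), Finset.sum_Icc_succ_top (by omega)]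
      have h3 : √(ℓ * noiseVar f σ₀ σ₁ (w (m + 1))) ≤ √ℓ * K := by
        rw [Real.sqrt_mul (by linarith)]
        exact mul_le_mul_of_nonneg_left
          (Real.sqrt_le_iff.2 ⟨hK, hvar _ (hgap _ hmem)⟩) (Real.sqrt_nonneg _)
      have h4 : (9 / 2 * η * √(ℓ * noiseVar f σ₀ σ₁ (w (m + 1))) + β / 2 * η ^ 2)
            * (‖g (m + 1)‖ ^ 2 / adaAccum γ g (m + 1))
          ≤ (9 / 2 * η * (√ℓ * K) + β / 2 * η ^ 2)
            * (‖g (m + 1)‖ ^ 2 / adaAccum γ g (m + 1)) := by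
        refine mul_le_mul_of_nonneg_right ?_
          (div_nonneg (sq_nonneg _) (adaAccum_pos hγ _).le)
        gcongr
      simp only [he, hN] at h1 ⊢
      linarith
  have hM : ∑ s ∈ Finset.Icc 1 n, (-(e s * N s) - 1 / 2 * (e s * ‖gradient f (w s)‖ ^ 2))
      ≤ 8 * η * K * x := by
    rcases Nat.eq_zero_or_pos n with rfl | hn0
    · simp only [Finset.Icc_eq_empty_of_lt zero_lt_one, Finset.sum_empty]
      positivity
    rcases hK.eq_or_lt with hK0 | hKpos
    · -- the scale `1 / (8 η K)` is a junk value here, but without variance there is no noise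
      have : ∀ s ∈ Finset.Icc 1 n,
          -(e s * N s) - 1 / 2 * (e s * ‖gradient f (w s)‖ ^ 2) ≤ 0 := by
        intro s hs
        have h1 := hvar _ (hgap s hs)
        have h2 := hnoise s (hsT s hs)
        have h3 : ‖g s - gradient f (w s)‖ ^ 2 ≤ 0 := by
          rw [← hK0] at h1
          nlinarith
        have h4 : g s - gradient f (w s) = 0 := by
          rw [← norm_eq_zero]
          exact pow_eq_zero_iff (two_ne_zero) |>.1 (le_antisymm h3 (sq_nonneg _))
        have h5 : 0 ≤ e s := decorStep_nonneg hη.le s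
        have : 0 ≤ e s * ‖gradient f (w s)‖ ^ 2 := by positivity
        simp only [hN, h4, inner_zero_right]
        linarith
      exact (Finset.sum_nonpos this).trans (by positivity)
    · have h1 := hmart n (Finset.mem_Icc.2 ⟨hn0, hn⟩)
      have h2 : ∑ s ∈ Finset.Icc 1 n, 1 / (8 * η * K) *
          (-(e s * N s) - 1 / 2 * (e s * ‖gradient f (w s)‖ ^ 2)) ≤ x := by
        refine (Finset.sum_le_sum fun s hs => ?_).trans h1
        have h5 : 0 ≤ e s := decorStep_nonneg hη.le s
        have h7 : √(noiseVar f σ₀ σ₁ (w s)) ≤ K := Real.sqrt_le_iff.2 ⟨hK, hvar _ (hgap s hs)⟩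
        have h6 : e s * √(noiseVar f σ₀ σ₁ (w s)) ≤ η := by
          refine le_trans ?_ (decorStep_mul_sqrt_le (f := f) (σ₀ := σ₀) (σ₁ := σ₁) (γ := γ)
            (ℓ := ℓ) (w := w) (g := g) hη.le s)
          exact mul_le_mul_of_nonneg_left (Real.sqrt_le_sqrt
            (le_mul_of_one_le_left (noiseVar_nonneg _) hℓ)) h5
        have h8 : e s * noiseVar f σ₀ σ₁ (w s) ≤ η * K := by
          rw [← Real.mul_self_sqrt (noiseVar_nonneg (f := f) (σ₀ := σ₀) (σ₁ := σ₁) (w s)),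
            ← mul_assoc]
          exact mul_le_mul h6 h7 (Real.sqrt_nonneg _) hη.le
        rw [gapWeight, if_pos (hgap s hs), inner_smul_left, norm_smul, mul_pow, Real.norm_eq_abs,
          sq_abs]
        simp only [conj_trivial]
        have h9 : 4 * ((-(1 / (8 * η * K) * e s)) ^ 2 * ‖gradient f (w s)‖ ^ 2)
            * noiseVar f σ₀ σ₁ (w s) = 1 / (8 * η * K) *
            (1 / 2 * (e s * ‖gradient f (w s)‖ ^ 2) *
              ((e s * noiseVar f σ₀ σ₁ (w s)) / (η * K))) := by
          field_simp
          ring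
        have h10 : (e s * noiseVar f σ₀ σ₁ (w s)) / (η * K) ≤ 1 :=
          (div_le_one (by positivity)).2 h8
        have h11 : 1 / (8 * η * K) * (1 / 2 * (e s * ‖gradient f (w s)‖ ^ 2) *
              ((e s * noiseVar f σ₀ σ₁ (w s)) / (η * K)))
            ≤ 1 / (8 * η * K) * (1 / 2 * (e s * ‖gradient f (w s)‖ ^ 2)) := by
          refine mul_le_mul_of_nonneg_left ?_ (by positivity)
          exact mul_le_of_le_one_right (by positivity) h10
        rw [← he, h9]
        simp only [hN]
        linarith
      rw [← Finset.mul_sum, one_div, inv_mul_le_iff₀ (by positivity)] at h2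
      exact h2
  have h1 := hsum n le_rfl
  have h2 : (9 / 2 * η * (√ℓ * K) + β / 2 * η ^ 2)
        * ∑ s ∈ Finset.Icc 1 n, ‖g s‖ ^ 2 / adaAccum γ g s ≤
      (9 / 2 * η * (√ℓ * K) + β / 2 * η ^ 2) * Λ :=
    mul_le_mul_of_nonneg_left (hΛ n hn) (by positivity)
  linarith

/-- Dividing the descent inequality by the stepsize and summing by parts. -/
lemma sum_inner_le (hf : IsBetaSmooth β f) (hβ : 0 ≤ β) (hη : 0 < η) (hγ : 0 < γ)
    (hstep : ∀ t ∈ Finset.Icc 1 T, w (t + 1) = w t - adaStep η γ g t • g t)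
    (hgap : ∀ t ∈ Finset.Icc 1 (T + 1), f (w t) - fstar ≤ F) (t : ℕ) (ht : t ≤ T) :
    ∑ s ∈ Finset.Icc 1 t, inner ℝ (gradient f (w s)) (g s) ≤
      γ / η * (f (w 1) - fstar) + (F / η + η * β) * (√(adaAccum γ g t) - γ)
        - (f (w (t + 1)) - fstar) * √(adaAccum γ g t) / η := by
  induction t with
  | zero =>
    simp only [Finset.Icc_eq_empty_of_lt zero_lt_one, Finset.sum_empty, adaAccum_zero,
      Real.sqrt_sq hγ.le]
    apply le_of_eq
    ring
  | succ t ih =>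
    have h1 := ih (by omega)
    have hmem : t + 1 ∈ Finset.Icc 1 T := Finset.mem_Icc.2 ⟨by omega, ht⟩
    have h2 := descent_iterate hf hγ hstep hmem
    have hs := adaAccum_succ (γ := γ) (g := g) t
    have e1 : adaStep η γ g (t + 1) = η / √(adaAccum γ g (t + 1)) := rfl
    rw [e1] at h2
    have h3 := hgap (t + 1) (Finset.mem_Icc.2 (by omega))
    rw [Finset.sum_Icc_succ_top (by omega)]
    have hp : 0 < √(adaAccum γ g t) := Real.sqrt_pos.2 (adaAccum_pos hγ _)
    have hq : 0 < √(adaAccum γ g (t + 1)) := Real.sqrt_pos.2 (adaAccum_pos hγ _)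
    have hp2 := Real.sq_sqrt (adaAccum_pos (g := g) hγ t).le
    have hq2 := Real.sq_sqrt (adaAccum_pos (g := g) hγ (t + 1)).le
    have hpq : √(adaAccum γ g t) ≤ √(adaAccum γ g (t + 1)) :=
      Real.sqrt_le_sqrt (by rw [hs]; nlinarith [sq_nonneg ‖g (t + 1)‖])
    have hx : ‖g (t + 1)‖ ^ 2 / adaAccum γ g (t + 1) ≤
        2 * (√(adaAccum γ g (t + 1)) - √(adaAccum γ g t)) / √(adaAccum γ g (t + 1)) := by
      rw [div_le_div_iff₀ (adaAccum_pos hγ _) hq]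
      have : ‖g (t + 1)‖ ^ 2 = √(adaAccum γ g (t + 1)) ^ 2 - √(adaAccum γ g t) ^ 2 := by
        linarith
      rw [this]
      nth_rw 4 [← hq2]
      nlinarith [mul_nonneg hq.le (sq_nonneg (√(adaAccum γ g (t + 1)) - √(adaAccum γ g t)))]
    set p := √(adaAccum γ g t)
    set q := √(adaAccum γ g (t + 1))
    set I : ℝ := inner ℝ (gradient f (w (t + 1))) (g (t + 1))
    have h4 : η / q * I ≤
        f (w (t + 1)) - f (w (t + 1 + 1)) + β / 2 * η ^ 2 * (2 * (q - p) / q) := by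
      have := mul_le_mul_of_nonneg_left hx (by positivity : 0 ≤ β / 2 * η ^ 2)
      linarith
    have h5 := mul_le_mul_of_nonneg_left h4 (by positivity : 0 ≤ q / η)
    have e2 : q / η * (η / q * I) = I := by field_simp
    have e3 : q / η * (f (w (t + 1)) - f (w (t + 1 + 1)) + β / 2 * η ^ 2 * (2 * (q - p) / q)) =
        (f (w (t + 1)) - f (w (t + 1 + 1))) * q / η + η * β * (q - p) := by
      field_simp
    have h6 : (f (w (t + 1)) - fstar) * (q - p) / η ≤ F * (q - p) / η := by
      have := sub_nonneg.2 hpq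
      gcongr
    rw [e2, e3] at h5
    have e4 : (F / η + η * β) * (q - γ) - (f (w (t + 1 + 1)) - fstar) * q / η =
      (F / η + η * β) * (p - γ) - (f (w (t + 1)) - fstar) * p / η + (F * (q - p) / η
        + η * β * (q - p) + ((f (w (t + 1)) - f (w (t + 1 + 1))) * q / η
        - (f (w (t + 1)) - fstar) * (q - p) / η)) := by ring
    linarith

end Path

section Path

variable {d : ℕ} {f : EuclideanSpace ℝ (Fin d) → ℝ} {β σ₀ σ₁ η γ ℓ fstar F : ℝ} {T : ℕ}
  {w g : ℕ → EuclideanSpace ℝ (Fin d)}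

/-- The weights of the noise in the martingale that controls the average squared gradient. -/
noncomputable def avgWeight (f : EuclideanSpace ℝ (Fin d) → ℝ) (fstar F c : ℝ)
    (w : ℕ → EuclideanSpace ℝ (Fin d)) (t : ℕ) : EuclideanSpace ℝ (Fin d) :=
  if f (w t) - fstar ≤ F then (-c) • gradient f (w t) else 0

/-- A quarter of the sum of squared gradients pays for the linear term `⟨∇f(w_t), ξ_t⟩` in the noise
`ξ_t`, up to `16 K x`. -/
lemma neg_sum_inner_noise_le {K x : ℝ}
    (hnoise : ∀ s ∈ Finset.Icc 1 T,
      ‖g s - gradient f (w s)‖ ^ 2 ≤ ℓ * noiseVar f σ₀ σ₁ (w s))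
    (hgap : ∀ t ∈ Finset.Icc 1 (T + 1), f (w t) - fstar ≤ F)
    (hx : 0 ≤ x) (hℓ : 0 ≤ ℓ) (hK : 0 ≤ K)
    (hvar : ∀ z, f z - fstar ≤ F → noiseVar f σ₀ σ₁ z ≤ K)
    (hmart : ∑ s ∈ Finset.Icc 1 T,
      (inner ℝ (avgWeight f fstar F (1 / (16 * K)) w s) (g s - gradient f (w s))
        - 4 * ‖avgWeight f fstar F (1 / (16 * K)) w s‖ ^ 2 * noiseVar f σ₀ σ₁ (w s)) ≤ x) :
    -∑ s ∈ Finset.Icc 1 T, inner ℝ (gradient f (w s)) (g s - gradient f (w s)) ≤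
      1 / 4 * ∑ s ∈ Finset.Icc 1 T, ‖gradient f (w s)‖ ^ 2 + 16 * K * x := by
  have hgap' : ∀ s ∈ Finset.Icc 1 T, f (w s) - fstar ≤ F := fun s hs =>
    hgap s (Finset.mem_Icc.2 (by have := Finset.mem_Icc.1 hs; omega))
  rcases hK.eq_or_lt with hK0 | hKpos
  · -- the scale `1 / (16 K)` is a junk value here, but without variance there is no noise
    have : ∑ s ∈ Finset.Icc 1 T, inner ℝ (gradient f (w s)) (g s - gradient f (w s)) = 0 := by
      refine Finset.sum_eq_zero fun s hs => ?_
      have h1 := hvar _ (hgap' s hs)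
      have h2 := hnoise s hs
      have h3 : ‖g s - gradient f (w s)‖ ^ 2 ≤ 0 := by nlinarith
      have h4 : g s - gradient f (w s) = 0 := by
        rw [← norm_eq_zero]
        exact pow_eq_zero_iff (two_ne_zero) |>.1 (le_antisymm h3 (sq_nonneg _))
      rw [h4, inner_zero_right]
    rw [this, neg_zero]
    have := Finset.sum_nonneg (s := Finset.Icc 1 T) fun s _ => sq_nonneg ‖gradient f (w s)‖
    positivity
  · have h2 : ∑ s ∈ Finset.Icc 1 T, 1 / (16 * K) *
        (-inner ℝ (gradient f (w s)) (g s - gradient f (w s))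
          - 1 / 4 * ‖gradient f (w s)‖ ^ 2) ≤ x := by
      refine (Finset.sum_le_sum fun s hs => ?_).trans hmart
      rw [avgWeight, if_pos (hgap' s hs), inner_smul_left, norm_smul, mul_pow, Real.norm_eq_abs,
        sq_abs]
      simp only [conj_trivial]
      have h9 : 4 * ((-(1 / (16 * K))) ^ 2 * ‖gradient f (w s)‖ ^ 2) * noiseVar f σ₀ σ₁ (w s)
          = 1 / (16 * K) * (1 / 4 * ‖gradient f (w s)‖ ^ 2 * (noiseVar f σ₀ σ₁ (w s) / K)) := by
        field_simp
        ring
      have h10 : noiseVar f σ₀ σ₁ (w s) / K ≤ 1 := (div_le_one hKpos).2 (hvar _ (hgap' s hs))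
      have h11 : 1 / (16 * K) * (1 / 4 * ‖gradient f (w s)‖ ^ 2 * (noiseVar f σ₀ σ₁ (w s) / K))
          ≤ 1 / (16 * K) * (1 / 4 * ‖gradient f (w s)‖ ^ 2) :=
        mul_le_mul_of_nonneg_left (mul_le_of_le_one_right (by positivity) h10) (by positivity)
      rw [h9]
      linarith
    rw [← Finset.mul_sum, one_div, inv_mul_le_iff₀ (by positivity), Finset.sum_sub_distrib,
      Finset.sum_neg_distrib, ← Finset.mul_sum] at h2
    linarith

/-- The bound on the sum of squared gradients, once the optimality gap is bounded by `F`. -/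
lemma sum_sq_gradient_le {K x D : ℝ} (hf : IsBetaSmooth β f) (hβ : 0 ≤ β) (hη : 0 < η)
    (hγ : 0 < γ) (hℓ : 0 ≤ ℓ) (hσ₀ : 0 ≤ σ₀) (hσ₁ : 0 ≤ σ₁) (hmin : ∀ z, fstar ≤ f z)
    (hstep : ∀ t ∈ Finset.Icc 1 T, w (t + 1) = w t - adaStep η γ g t • g t)
    (hnoise : ∀ s ∈ Finset.Icc 1 T,
      ‖g s - gradient f (w s)‖ ^ 2 ≤ ℓ * noiseVar f σ₀ σ₁ (w s))
    (hgap : ∀ t ∈ Finset.Icc 1 (T + 1), f (w t) - fstar ≤ F)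
    (hx : 0 ≤ x) (hK : 0 ≤ K) (hvar : ∀ z, f z - fstar ≤ F → noiseVar f σ₀ σ₁ z ≤ K)
    (hmart : ∑ s ∈ Finset.Icc 1 T,
      (inner ℝ (avgWeight f fstar F (1 / (16 * K)) w s) (g s - gradient f (w s))
        - 4 * ‖avgWeight f fstar F (1 / (16 * K)) w s‖ ^ 2 * noiseVar f σ₀ σ₁ (w s)) ≤ x)
    (hD0 : 0 ≤ F / η + η * β) (hD : F / η + η * β ≤ D) :
    ∑ s ∈ Finset.Icc 1 T, ‖gradient f (w s)‖ ^ 2 ≤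
      2 * (γ / η * (f (w 1) - fstar)) + 8 * D ^ 2 + 8 * ℓ * σ₁ ^ 2 * D ^ 2
        + 2 * D * (σ₀ * √(2 * ℓ * T)) + 32 * K * x := by
  have hM := neg_sum_inner_noise_le hnoise hgap hx hℓ hK hvar hmart
  have hI := sum_inner_le hf hβ hη hγ hstep hgap T le_rfl
  set S := ∑ s ∈ Finset.Icc 1 T, ‖gradient f (w s)‖ ^ 2 with hS
  have hS0 : 0 ≤ S := Finset.sum_nonneg fun s _ => sq_nonneg _
  have hsplit : ∑ s ∈ Finset.Icc 1 T, inner ℝ (gradient f (w s)) (g s) =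
      S + ∑ s ∈ Finset.Icc 1 T, inner ℝ (gradient f (w s)) (g s - gradient f (w s)) := by
    rw [hS, ← Finset.sum_add_distrib]
    refine Finset.sum_congr rfl fun s _ => ?_
    rw [inner_sub_right, real_inner_self_eq_norm_sq]
    ring
  have hQ : adaAccum γ g T ≤ γ ^ 2 + 2 * S + 2 * ℓ * (σ₀ ^ 2 * T + σ₁ ^ 2 * S) := by
    have : ∀ s ∈ Finset.Icc 1 T, ‖g s‖ ^ 2 ≤ 2 * ℓ * σ₀ ^ 2
        + (2 + 2 * ℓ * σ₁ ^ 2) * ‖gradient f (w s)‖ ^ 2 := by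
      intro s hs
      have h1 := hnoise s hs
      unfold noiseVar at h1
      have := norm_le_norm_add_norm_sub' (g s) (gradient f (w s))
      nlinarith [sq_nonneg (‖gradient f (w s)‖ - ‖g s - gradient f (w s)‖), norm_nonneg (g s)]
    have := Finset.sum_le_sum this
    rw [Finset.sum_add_distrib, Finset.sum_const, Nat.card_Icc, Nat.add_sub_cancel, nsmul_eq_mul,
      ← Finset.mul_sum, ← hS] at this
    unfold adaAccum
    linarith
  have hr := Real.sq_sqrt hS0
  have h2 := Real.sq_sqrt (zero_le_two (α := ℝ))
  have h2ℓ := Real.sq_sqrt (by positivity : 0 ≤ 2 * ℓ)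
  have h2ℓT := Real.sq_sqrt (by positivity : 0 ≤ 2 * ℓ * T)
  have hsqrt : √(adaAccum γ g T) ≤
      γ + (√2 * √S + σ₀ * √(2 * ℓ * T) + √(2 * ℓ) * σ₁ * √S) := by
    rw [Real.sqrt_le_iff]
    refine ⟨by positivity, hQ.trans ?_⟩
    have ha : 0 ≤ √2 * √S := by positivity
    have hb : 0 ≤ σ₀ * √(2 * ℓ * T) := by positivity
    have hc : 0 ≤ √(2 * ℓ) * σ₁ * √S := by positivity
    have e : γ ^ 2 + 2 * S + 2 * ℓ * (σ₀ ^ 2 * T + σ₁ ^ 2 * S) =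
        γ ^ 2 + (√2 * √S) ^ 2 + (σ₀ * √(2 * ℓ * T)) ^ 2 + (√(2 * ℓ) * σ₁ * √S) ^ 2 := by
      rw [mul_pow, mul_pow, mul_pow, mul_pow, hr, h2, h2ℓ, h2ℓT]
      ring
    have e' : ∀ a b c : ℝ, (γ + (a + b + c)) ^ 2 = γ ^ 2 + a ^ 2 + b ^ 2 + c ^ 2
        + 2 * (a * b + a * c + b * c + γ * (a + b + c)) := fun a b c => by ring
    rw [e, e']
    have : 0 ≤ γ * (√2 * √S + σ₀ * √(2 * ℓ * T) + √(2 * ℓ) * σ₁ * √S) := by positivity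
    linarith [mul_nonneg ha hb, mul_nonneg ha hc, mul_nonneg hb hc]
  have hlast : 0 ≤ (f (w (T + 1)) - fstar) * √(adaAccum γ g T) / η := by
    have := sub_nonneg.2 (hmin (w (T + 1)))
    positivity
  have hD' : 0 ≤ D := hD0.trans hD
  have hmain : (F / η + η * β) * (√(adaAccum γ g T) - γ) ≤
      D * (√2 * √S + σ₀ * √(2 * ℓ * T) + √(2 * ℓ) * σ₁ * √S) := by
    refine (mul_le_mul_of_nonneg_left (sub_le_iff_le_add'.2 hsqrt) hD0).trans ?_
    exact mul_le_mul_of_nonneg_right hD (by positivity)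
  have haux : ∀ y, y * √S ≤ S / 8 + 2 * y ^ 2 := fun y => by
    nlinarith [sq_nonneg (√S - 4 * y)]
  have h3 := haux (D * √2)
  have h4 := haux (D * √(2 * ℓ) * σ₁)
  rw [mul_pow, h2] at h3
  rw [mul_pow, mul_pow, h2ℓ] at h4
  linarith

end Path

/-! ### The explicit bound on the optimality gap -/

section Numerics

variable {β σ₀ σ₁ η γ δ Δ₁ : ℝ} {T : ℕ}

lemma two_le_log_four_mul_div (hT : 1 ≤ T) (hδ : 0 < δ) (hδ3 : δ < 1 / 3) :
    2 ≤ Real.log (4 * T / δ) := by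
  have hT' : (1 : ℝ) ≤ T := by exact_mod_cast hT
  have h12 : 12 ≤ 4 * T / δ := by
    rw [le_div_iff₀ hδ]
    linarith
  rw [Real.le_log_iff_exp_le (by linarith)]
  have h1 := Real.exp_one_lt_d9
  have h2 : Real.exp 2 = Real.exp 1 ^ 2 := by
    rw [← Real.exp_nat_mul]
    norm_num
  have h0 := Real.exp_pos 1
  nlinarith

lemma boundC₁_nonneg (hγ : 0 < γ) (hβ : 0 ≤ β) (hΔ : 0 ≤ Δ₁)
    (hℓ : 0 ≤ Real.log (4 * T / δ)) : 0 ≤ boundC₁ β σ₀ σ₁ η γ δ Δ₁ T := by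
  refine Real.logb_nonneg one_lt_two ?_
  have : 0 ≤ (18 * σ₀ ^ 2 * T * Real.log (4 * T / δ)
      + (8 + 72 * σ₁ ^ 2 * Real.log (4 * T / δ))
        * (η ^ 2 * β ^ 2 * (T : ℝ) ^ 3 + β * Δ₁ * T)) / γ ^ 2 := by positivity
  linarith

lemma boundF_nonneg (hη : 0 < η) (hγ : 0 < γ) (hβ : 0 ≤ β) (hσ₀ : 0 ≤ σ₀) (hΔ : 0 ≤ Δ₁)
    (hℓ : 0 ≤ Real.log (4 * T / δ)) (hL : 0 ≤ Real.logb 2 (T / δ)) :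
    0 ≤ boundF β σ₀ σ₁ η γ δ Δ₁ T := by
  have := boundC₁_nonneg (σ₀ := σ₀) (σ₁ := σ₁) (η := η) hγ hβ hΔ hℓ
  unfold boundF
  positivity

/-- `boundF` solves the inequality under which the induction for the optimality gap closes. -/
lemma boundF_closes (hη : 0 < η) (hγ : 0 < γ) (hβ : 0 ≤ β) (hσ₀ : 0 ≤ σ₀) (hσ₁ : 0 ≤ σ₁)
    (hΔ : 0 ≤ Δ₁) (hT : 1 ≤ T) (hδ : 0 < δ) (hδ3 : δ < 1 / 3) {F C Λ : ℝ}
    (hF : F = boundF β σ₀ σ₁ η γ δ Δ₁ T) (hC : C = boundC₁ β σ₀ σ₁ η γ δ Δ₁ T)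
    (hΛ : Λ = Real.log 2 * C) :
    Δ₁ + 8 * η * (σ₀ + σ₁ * √(2 * β * F)) * Real.log (T / δ)
      + 9 / 2 * η * (√(Real.log (4 * T / δ)) * (σ₀ + σ₁ * √(2 * β * F))) * Λ
      + β / 2 * η ^ 2 * Λ ≤ F := by
  have hℓ := two_le_log_four_mul_div hT hδ hδ3
  have hT' : (1 : ℝ) ≤ T := by exact_mod_cast hT
  have hL : 0 ≤ Real.logb 2 (T / δ) := Real.logb_nonneg one_lt_two (by
    rw [le_div_iff₀ hδ]
    linarith)
  have hF0 : 0 ≤ F := hF ▸ boundF_nonneg hη hγ hβ hσ₀ hΔ (by linarith) hL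
  have hC0 : 0 ≤ C := hC ▸ boundC₁_nonneg hγ hβ hΔ (by linarith)
  have hx : Real.log (T / δ) = Real.log 2 * Real.logb 2 (T / δ) := by
    rw [Real.logb]
    field_simp
  rw [boundF, ← hC] at hF
  rw [hx, hΛ]
  clear hx hΛ hC
  -- `ℓ ≥ 2` makes `√ℓ` large enough for the coefficient `9 / 2` of `L`
  have hs := Real.sq_sqrt (by linarith : 0 ≤ Real.log (4 * T / δ))
  have hs0 : 1.4 ≤ √(Real.log (4 * T / δ)) := Real.le_sqrt_of_sq_le (by norm_num; linarith)
  set L := Real.logb 2 (T / δ)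
  set s := √(Real.log (4 * T / δ))
  rw [← hs] at hF
  have hln := Real.log_two_lt_d9
  have hln0 := Real.log_pos one_lt_two
  set R := √(2 * β * F) with hR
  have hR0 : 0 ≤ R := Real.sqrt_nonneg _
  have hR2 : R ^ 2 = 2 * β * F := Real.sq_sqrt (by positivity)
  set K := σ₀ + σ₁ * R with hK
  have hK0 : 0 ≤ K := by positivity
  have hs1 : 0 ≤ s := by linarith
  have h1 : 8 * η * K * (Real.log 2 * L) ≤ 9 / 2 * L * η * s * K := by
    have : 8 * Real.log 2 ≤ 9 / 2 * s := by linarith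
    have := mul_le_mul_of_nonneg_right this (by positivity : 0 ≤ η * K * L)
    linarith
  have h2 : 9 / 2 * η * (s * K) * (Real.log 2 * C) ≤ 6 * C * η * s * K := by
    have : 9 / 2 * Real.log 2 ≤ 6 := by linarith
    have := mul_le_mul_of_nonneg_right this (by positivity : 0 ≤ η * s * K * C)
    linarith
  have h3 : β / 2 * η ^ 2 * (Real.log 2 * C) ≤ β / 2 * η ^ 2 * C := by
    have : Real.log 2 ≤ 1 := by linarith
    have := mul_le_mul_of_nonneg_right this (by positivity : 0 ≤ β / 2 * η ^ 2 * C)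
    linarith
  set κ := (9 / 2 * L + 6 * C) * η with hκ
  have h4 : κ * s * σ₁ * R ≤ F / 2 + β * (κ * s * σ₁) ^ 2 := by
    refine abs_le_of_sq_le_sq' ?_ (by positivity) |>.2
    rw [mul_pow, hR2]
    nlinarith [sq_nonneg (F / 2 - β * (κ * s * σ₁) ^ 2)]
  have h5 : κ ^ 2 ≤ (81 / 2 * L ^ 2 + 72 * C ^ 2) * η ^ 2 := by
    rw [hκ, mul_pow]
    refine mul_le_mul_of_nonneg_right ?_ (sq_nonneg _)
    nlinarith [sq_nonneg (9 / 2 * L - 6 * C)]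
  have h6 : β * (κ * s * σ₁) ^ 2 ≤ (81 / 2 * L ^ 2 + 72 * C ^ 2) * η ^ 2 * β * σ₁ ^ 2 * s ^ 2 := by
    have := mul_le_mul_of_nonneg_right h5 (by positivity : 0 ≤ β * σ₁ ^ 2 * s ^ 2)
    linarith
  have h7 : 9 / 2 * L * η * s * K + 6 * C * η * s * K = κ * s * σ₀ + κ * s * σ₁ * R := by
    rw [hκ, hK]
    ring
  have h8 : κ * s * σ₀ = (9 / 2 * L + 6 * C) * η * σ₀ * s := by
    rw [hκ]
    ring
  have h9 : 0 ≤ η ^ 2 * β * C := by positivity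
  linarith

end Numerics

/-! ### Moment generating functions of sub-Gaussian vectors -/

lemma exp_le_add_exp_sq (x : ℝ) : Real.exp x ≤ x + Real.exp (x ^ 2) := by
  have h2 := Real.add_one_le_exp (x ^ 2)
  rcases le_total |x| 1 with h | h
  · have := (abs_le.1 (Real.abs_exp_sub_one_sub_id_le h)).2
    linarith
  · rcases le_total 0 x with h0 | h0
    · rw [abs_of_nonneg h0] at h
      have : Real.exp x ≤ Real.exp (x ^ 2) := Real.exp_le_exp.2 (by nlinarith)
      linarith
    · rw [abs_of_nonpos h0] at h
      have : Real.exp x ≤ 1 := Real.exp_le_one_iff.2 h0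
      nlinarith

/-- A sub-Gaussian tail bounds the exponential moments of the square. -/
lemma lintegral_exp_sq_le {Ω : Type*} [MeasurableSpace Ω] {μ : Measure Ω} [IsProbabilityMeasure μ]
    {Y : Ω → ℝ} (hY : Measurable Y) (hY0 : ∀ ω, 0 ≤ Y ω) {v θ : ℝ} (hv : 0 < v) (hθ : 0 < θ)
    (hθ1 : θ < 1) (htail : ∀ t, 0 < t → μ.real {ω | t ≤ Y ω} ≤ 2 * Real.exp (-(t ^ 2 / v))) :
    ∫⁻ ω, ENNReal.ofReal (Real.exp (θ * (Y ω ^ 2 / v))) ∂μ ≤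
      ENNReal.ofReal (1 + 2 * θ / (1 - θ)) := by
  have hlayer := lintegral_comp_eq_lintegral_meas_le_mul μ (f := fun ω => θ * (Y ω ^ 2 / v))
    (g := Real.exp) (.of_forall fun ω => by positivity) (by fun_prop)
    (fun t _ => Real.continuous_exp.intervalIntegrable _ _)
    (.of_forall fun t => (Real.exp_pos t).le)
  simp only [integral_exp, Real.exp_zero] at hlayer
  have hθ' : 0 < 1 - θ := by linarith
  have ha : (θ - 1) / θ < 0 := div_neg_of_neg_of_pos (by linarith) hθ
  have hbound : ∫⁻ t in Set.Ioi (0 : ℝ), μ {ω | t ≤ θ * (Y ω ^ 2 / v)} * ENNReal.ofReal (Real.exp t)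
      ≤ ENNReal.ofReal (2 * θ / (1 - θ)) := by
    have hint : IntegrableOn (fun t : ℝ => 2 * Real.exp ((θ - 1) / θ * t)) (Set.Ioi 0) :=
      (integrableOn_exp_mul_Ioi ha 0).const_mul 2
    calc _ ≤ ∫⁻ t in Set.Ioi (0 : ℝ), ENNReal.ofReal (2 * Real.exp ((θ - 1) / θ * t)) := by
          refine setLIntegral_mono' measurableSet_Ioi fun t (ht : 0 < t) => ?_
          have hset : {ω | t ≤ θ * (Y ω ^ 2 / v)} = {ω | √(t * v / θ) ≤ Y ω} := by
            ext ω
            rw [Set.mem_ofPred_eq, Set.mem_ofPred_eq, Real.sqrt_le_left (hY0 ω), div_le_iff₀ hθ,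
              ← mul_div_assoc, le_div_iff₀ hv, mul_comm θ]
          have h1 := htail (√(t * v / θ)) (by positivity)
          rw [Real.sq_sqrt (by positivity)] at h1
          rw [hset, ← ofReal_measureReal, ← ENNReal.ofReal_mul measureReal_nonneg]
          refine ENNReal.ofReal_le_ofReal ?_
          refine (mul_le_mul_of_nonneg_right h1 (Real.exp_pos t).le).trans (le_of_eq ?_)
          rw [mul_assoc, ← Real.exp_add]
          congr 2
          field_simp
          ring
      _ = ENNReal.ofReal (∫ t in Set.Ioi (0 : ℝ), 2 * Real.exp ((θ - 1) / θ * t)) :=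
          (ofReal_integral_eq_lintegral_ofReal hint
            (.of_forall fun t => by positivity)).symm
      _ ≤ _ := by
          refine ENNReal.ofReal_le_ofReal (le_of_eq ?_)
          rw [integral_const_mul, integral_exp_mul_Ioi ha]
          have : θ - 1 ≠ 0 := by linarith
          simp only [mul_zero, Real.exp_zero]
          field_simp
          ring
  calc ∫⁻ ω, ENNReal.ofReal (Real.exp (θ * (Y ω ^ 2 / v))) ∂μ
      = ∫⁻ ω, (1 + ENNReal.ofReal (Real.exp (θ * (Y ω ^ 2 / v)) - 1)) ∂μ := by
        refine lintegral_congr fun ω => ?_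
        have : 1 ≤ Real.exp (θ * (Y ω ^ 2 / v)) := Real.one_le_exp (by positivity)
        rw [← ENNReal.ofReal_one, ← ENNReal.ofReal_add zero_le_one (by linarith)]
        congr 1
        ring
    _ = 1 + ∫⁻ ω, ENNReal.ofReal (Real.exp (θ * (Y ω ^ 2 / v)) - 1) ∂μ := by
        rw [lintegral_add_left measurable_const]
        simp
    _ ≤ 1 + ENNReal.ofReal (2 * θ / (1 - θ)) := by
        rw [hlayer]
        gcongr
    _ = _ := by
        rw [ENNReal.ofReal_add zero_le_one (by positivity), ENNReal.ofReal_one]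

section Mgf

variable {E : Type*} [NormedAddCommGroup E] [InnerProductSpace ℝ E] [CompleteSpace E]
  [MeasurableSpace E] [BorelSpace E] {μ : Measure E}
  [IsProbabilityMeasure μ] {m : E} {v : ℝ}

/-- A vector with mean `m` and a sub-Gaussian tail has a sub-Gaussian moment generating function.
For small `u` this rests on `exp X ≤ X + exp (X²)` and the vanishing mean, for large `u` on Young's
inequality `⟨u, X⟩ ≤ ‖u‖² v + ‖X‖² / (4 v)`. -/
lemma lintegral_exp_inner_le_of_tail (hint : Integrable (fun x => x) μ) (hm : ∫ x, x ∂μ = m)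
    (hv : 0 < v) (htail : ∀ t, 0 < t → μ.real {x | t ≤ ‖x - m‖} ≤ 2 * Real.exp (-(t ^ 2 / v)))
    (u : E) :
    ∫⁻ x, ENNReal.ofReal (Real.exp (inner ℝ u (x - m))) ∂μ ≤
      ENNReal.ofReal (Real.exp (4 * ‖u‖ ^ 2 * v)) := by
  have hmeas : Measurable fun x : E => ‖x - m‖ := by fun_prop
  have hY := fun θ h0 h1 => lintegral_exp_sq_le (μ := μ) (θ := θ) hmeas
    (fun x => norm_nonneg _) hv h0 h1 htail
  have hinner : ∀ x, |inner ℝ u (x - m)| ≤ ‖u‖ * ‖x - m‖ := fun x => abs_real_inner_le_norm _ _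
  rcases eq_or_ne u 0 with rfl | hu
  · simp
  have hu0 : 0 < ‖u‖ := norm_pos_iff.2 hu
  set θ := ‖u‖ ^ 2 * v with hθ
  have hθ0 : 0 < θ := by positivity
  rcases le_total θ (1 / 2) with hθ1 | hθ1
  · have hb := hY θ hθ0 (by linarith)
    set e := fun x : E => Real.exp (θ * (‖x - m‖ ^ 2 / v)) with he
    have hemeas : Measurable e := by fun_prop
    have heint : Integrable e μ := by
      refine ⟨hemeas.aestronglyMeasurable, ?_⟩
      rw [hasFiniteIntegral_iff_ofReal (.of_forall fun x => (Real.exp_pos _).le)]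
      exact hb.trans_lt ENNReal.ofReal_lt_top
    have hXint : Integrable (fun x => inner ℝ u (x - m)) μ :=
      (hint.sub (integrable_const m)).const_inner u
    have hX0 : ∫ x, inner ℝ u (x - m) ∂μ = 0 := by
      have h := integral_inner (𝕜 := ℝ) (f := fun x : E => x - m)
        (hint.sub (integrable_const m)) u
      rw [h, integral_sub hint (integrable_const m), hm]
      simp
    have hle : ∀ x, Real.exp (inner ℝ u (x - m)) ≤ inner ℝ u (x - m) + e x := by
      intro x
      refine (exp_le_add_exp_sq _).trans (add_le_add_right (Real.exp_le_exp.2 ?_) _)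
      have h1 := pow_le_pow_left₀ (abs_nonneg _) (hinner x) 2
      rw [sq_abs] at h1
      refine h1.trans (le_of_eq ?_)
      rw [hθ]
      field_simp
    calc ∫⁻ x, ENNReal.ofReal (Real.exp (inner ℝ u (x - m))) ∂μ
        ≤ ∫⁻ x, ENNReal.ofReal (inner ℝ u (x - m) + e x) ∂μ :=
          lintegral_mono fun x => ENNReal.ofReal_le_ofReal (hle x)
      _ = ENNReal.ofReal (∫ x, (inner ℝ u (x - m) + e x) ∂μ) :=
          (ofReal_integral_eq_lintegral_ofReal (hXint.add heint)
            (.of_forall fun x => (Real.exp_pos _).le.trans (hle x))).symm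
      _ = ∫⁻ x, ENNReal.ofReal (e x) ∂μ := by
          rw [integral_add hXint heint, hX0, zero_add, ofReal_integral_eq_lintegral_ofReal heint
            (.of_forall fun x => (Real.exp_pos _).le)]
      _ ≤ ENNReal.ofReal (1 + 2 * θ / (1 - θ)) := hb
      _ ≤ _ := by
          refine ENNReal.ofReal_le_ofReal ?_
          have h1 : 2 * θ / (1 - θ) ≤ 4 * θ := by
            rw [div_le_iff₀ (by linarith)]
            nlinarith
          have h2 := Real.add_one_le_exp (4 * θ)
          rw [mul_assoc]
          linarith
  · have hb := hY (1 / 4) (by norm_num) (by norm_num)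
    calc ∫⁻ x, ENNReal.ofReal (Real.exp (inner ℝ u (x - m))) ∂μ
        ≤ ∫⁻ x, ENNReal.ofReal (Real.exp θ) *
            ENNReal.ofReal (Real.exp (1 / 4 * (‖x - m‖ ^ 2 / v))) ∂μ := by
          refine lintegral_mono fun x => ?_
          rw [← ENNReal.ofReal_mul (Real.exp_pos _).le, ← Real.exp_add]
          refine ENNReal.ofReal_le_ofReal (Real.exp_le_exp.2 ?_)
          refine (le_abs_self _).trans ((hinner x).trans ?_)
          have : θ + 1 / 4 * (‖x - m‖ ^ 2 / v) - ‖u‖ * ‖x - m‖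
              = (‖u‖ * v - ‖x - m‖ / 2) ^ 2 / v := by
            rw [hθ]
            field_simp
            ring
          have h0 : 0 ≤ (‖u‖ * v - ‖x - m‖ / 2) ^ 2 / v := by positivity
          linarith
      _ = ENNReal.ofReal (Real.exp θ) *
            ∫⁻ x, ENNReal.ofReal (Real.exp (1 / 4 * (‖x - m‖ ^ 2 / v))) ∂μ :=
          lintegral_const_mul _ (by fun_prop)
      _ ≤ ENNReal.ofReal (Real.exp θ) * ENNReal.ofReal (1 + 2 * (1 / 4) / (1 - 1 / 4)) := by
          gcongr
      _ ≤ _ := by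
          rw [← ENNReal.ofReal_mul (Real.exp_pos _).le]
          refine ENNReal.ofReal_le_ofReal ?_
          have h1 := Real.add_one_le_exp (3 * θ)
          have h2 : Real.exp (4 * ‖u‖ ^ 2 * v) = Real.exp θ * Real.exp (3 * θ) := by
            rw [← Real.exp_add, hθ]
            congr 1
            ring
          rw [h2]
          refine mul_le_mul_of_nonneg_left ?_ (Real.exp_pos _).le
          norm_num
          linarith

end Mgf

lemma subGaussianTail_le {v v' t : ℝ} (hv : 0 ≤ v) (hvv : v < v') :
    subGaussianTail v t ≤ 2 * Real.exp (-(t ^ 2 / v')) := by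
  unfold subGaussianTail
  split_ifs with h
  · positivity
  · have : 0 < v := lt_of_le_of_ne hv (Ne.symm h)
    gcongr

section Oracle

variable {d : ℕ} {f : EuclideanSpace ℝ (Fin d) → ℝ} {σ₀ σ₁ : ℝ}
  {κ : Kernel (EuclideanSpace ℝ (Fin d)) (EuclideanSpace ℝ (Fin d))}

lemma IsSubGaussianOracle.tail_le (hsub : IsSubGaussianOracle σ₀ σ₁ κ) (hκ : IsUnbiasedOracle f κ)
    (w : EuclideanSpace ℝ (Fin d)) {t : ℝ} (ht : 0 < t) :
    (κ w).real {x | t ≤ ‖x - gradient f w‖} ≤ subGaussianTail (noiseVar f σ₀ σ₁ w) t := by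
  simpa only [hκ.mean w, noiseVar] using hsub w t ht

lemma IsSubGaussianOracle.lintegral_exp_inner_le (hsub : IsSubGaussianOracle σ₀ σ₁ κ)
    (hκ : IsUnbiasedOracle f κ) (w u : EuclideanSpace ℝ (Fin d)) :
    ∫⁻ x, ENNReal.ofReal (Real.exp
      (inner ℝ u (x - gradient f w) - 4 * ‖u‖ ^ 2 * noiseVar f σ₀ σ₁ w)) ∂(κ w) ≤ 1 := by
  have := hκ.markov
  have h : ∫⁻ x, ENNReal.ofReal (Real.exp (inner ℝ u (x - gradient f w))) ∂(κ w) ≤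
      ENNReal.ofReal (Real.exp (4 * ‖u‖ ^ 2 * noiseVar f σ₀ σ₁ w)) := by
    -- the variance proxy may vanish, so it is approached from above
    have hcont : Continuous fun v => ENNReal.ofReal (Real.exp (4 * ‖u‖ ^ 2 * v)) :=
      ENNReal.continuous_ofReal.comp (by fun_prop)
    refine ge_of_tendsto ((hcont.tendsto (noiseVar f σ₀ σ₁ w)).mono_left
      (nhdsWithin_le_nhds (s := Set.Ioi (noiseVar f σ₀ σ₁ w)))) ?_
    filter_upwards [self_mem_nhdsWithin] with v hv
    have hv0 : 0 < v := (noiseVar_nonneg w).trans_lt hv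
    exact lintegral_exp_inner_le_of_tail (hκ.integrable w) (hκ.mean w) hv0
      (fun t ht => (hsub.tail_le hκ w ht).trans
        (subGaussianTail_le (noiseVar_nonneg w) hv)) u
  calc ∫⁻ x, ENNReal.ofReal (Real.exp
      (inner ℝ u (x - gradient f w) - 4 * ‖u‖ ^ 2 * noiseVar f σ₀ σ₁ w)) ∂(κ w)
      = ENNReal.ofReal (Real.exp (-(4 * ‖u‖ ^ 2 * noiseVar f σ₀ σ₁ w))) *
        ∫⁻ x, ENNReal.ofReal (Real.exp (inner ℝ u (x - gradient f w))) ∂(κ w) := by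
        rw [← lintegral_const_mul _ (by fun_prop)]
        refine lintegral_congr fun x => ?_
        rw [← ENNReal.ofReal_mul (Real.exp_pos _).le, ← Real.exp_add]
        congr 2
        ring
    _ ≤ ENNReal.ofReal (Real.exp (-(4 * ‖u‖ ^ 2 * noiseVar f σ₀ σ₁ w))) *
        ENNReal.ofReal (Real.exp (4 * ‖u‖ ^ 2 * noiseVar f σ₀ σ₁ w)) := by gcongr
    _ = 1 := by
        rw [← ENNReal.ofReal_mul (Real.exp_pos _).le, ← Real.exp_add]
        simp

lemma IsSubGaussianOracle.measure_noise_le (hsub : IsSubGaussianOracle σ₀ σ₁ κ)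
    (hκ : IsUnbiasedOracle f κ) (w : EuclideanSpace ℝ (Fin d)) {ℓ : ℝ} (hℓ : 0 < ℓ) :
    κ w {x | ℓ * noiseVar f σ₀ σ₁ w < ‖x - gradient f w‖ ^ 2} ≤
      ENNReal.ofReal (2 * Real.exp (-ℓ)) := by
  have := hκ.markov
  rcases (noiseVar_nonneg (f := f) (σ₀ := σ₀) (σ₁ := σ₁) w).eq_or_lt with hv | hv
  · have hsubset : {x | ℓ * noiseVar f σ₀ σ₁ w < ‖x - gradient f w‖ ^ 2} ⊆
        ⋃ n : ℕ, {x | 1 / ((n : ℝ) + 1) ≤ ‖x - gradient f w‖} := by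
      intro x hx
      rw [Set.mem_ofPred_eq, ← hv, mul_zero] at hx
      have hx' : 0 < ‖x - gradient f w‖ := by
        rcases (norm_nonneg (x - gradient f w)).eq_or_lt with h | h
        · rw [← h] at hx
          norm_num at hx
        · exact h
      obtain ⟨n, hn⟩ := exists_nat_one_div_lt hx'
      exact Set.mem_iUnion.2 ⟨n, hn.le⟩
    have hnull : κ w (⋃ n : ℕ, {x | 1 / ((n : ℝ) + 1) ≤ ‖x - gradient f w‖}) = 0 := by
      refine measure_iUnion_null fun n => ?_
      have h1 := hsub.tail_le hκ w (t := 1 / ((n : ℝ) + 1)) (by positivity)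
      rw [subGaussianTail, if_pos hv.symm] at h1
      exact (measureReal_eq_zero_iff (measure_ne_top _ _)).1 (le_antisymm h1 measureReal_nonneg)
    exact (measure_mono hsubset).trans (hnull.le.trans zero_le)
  · have h1 := hsub.tail_le hκ w (t := √(ℓ * noiseVar f σ₀ σ₁ w)) (by positivity)
    rw [subGaussianTail, if_neg hv.ne', Real.sq_sqrt (by positivity),
      mul_div_cancel_right₀ _ hv.ne'] at h1
    have hsubset : {x | ℓ * noiseVar f σ₀ σ₁ w < ‖x - gradient f w‖ ^ 2} ⊆
        {x | √(ℓ * noiseVar f σ₀ σ₁ w) ≤ ‖x - gradient f w‖} :=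
      fun x hx => Real.sqrt_le_iff.2 ⟨norm_nonneg _, le_of_lt hx⟩
    refine (measure_mono hsubset).trans ?_
    rw [← ofReal_measureReal]
    exact ENNReal.ofReal_le_ofReal h1

end Oracle

/-! ### Conditional laws and the exponential supermartingale -/

/-- If the conditional law of `Y` given the σ-algebra `m` is `κ (p ω)`, with `p` measurable for `m`,
then integrating a function of `(p, Y)` amounts to integrating out `Y` under `κ` first. -/
lemma lintegral_eq_lintegral_condLaw {Ω Ω' E : Type*} {m m0 : MeasurableSpace Ω}
    [MeasurableSpace Ω'] [MeasurableSpace E] {μ : Measure Ω} [IsProbabilityMeasure μ]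
    (hm : m ≤ m0) {p : Ω → Ω'} (hp : Measurable[m] p) {Y : Ω → E} (hY : Measurable Y)
    (κ : Kernel Ω' E) [IsMarkovKernel κ]
    (h : ∀ B : Set E, MeasurableSet B →
      μ[(Y ⁻¹' B).indicator (fun _ => (1 : ℝ)) | m] =ᵐ[μ] fun ω => (κ (p ω)).real B)
    {φ : Ω' × E → ENNReal} (hφ : Measurable φ) :
    ∫⁻ ω, φ (p ω, Y ω) ∂μ = ∫⁻ ω, ∫⁻ x, φ (p ω, x) ∂(κ (p ω)) ∂μ := by
  have hp0 : Measurable p := hp.mono hm le_rfl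
  have hlaw : μ.map (fun ω => (p ω, Y ω)) = (μ.map p) ⊗ₘ κ := by
    have := Measure.isProbabilityMeasure_map (μ := μ) (hp0.prodMk hY).aemeasurable
    refine Measure.ext_prod fun {A B} hA hB => ?_
    rw [Measure.map_apply (hp0.prodMk hY) (hA.prod hB), Measure.compProd_apply_prod hA hB,
      setLIntegral_map hA (κ.measurable_coe hB) hp0]
    have h1 := setIntegral_condExp hm (μ := μ) (s := p ⁻¹' A)
      ((integrable_const (1 : ℝ)).indicator (hY hB)) (hp hA)
    rw [setIntegral_congr_ae (g := fun ω => (κ (p ω)).real B) (hp0 hA)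
      ((h B hB).mono fun ω hω _ => hω), setIntegral_indicator (hY hB), setIntegral_const,
      smul_eq_mul, mul_one] at h1
    have h2 : (fun ω => (p ω, Y ω)) ⁻¹' A ×ˢ B = p ⁻¹' A ∩ Y ⁻¹' B := rfl
    have hmeas : Measurable fun ω => (κ (p ω)).real B :=
      (κ.measurable_coe hB).ennreal_toReal.comp hp0
    rw [h2, ← ofReal_measureReal, ← h1, ofReal_integral_eq_lintegral_ofReal]
    · exact lintegral_congr fun ω => ofReal_measureReal (measure_ne_top _ _)
    · refine Integrable.integrableOn (Integrable.of_bound hmeas.aestronglyMeasurable 1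
        (.of_forall fun ω => ?_))
      rw [Real.norm_of_nonneg measureReal_nonneg]
      exact measureReal_le_one
    · exact .of_forall fun ω => measureReal_nonneg
  rw [← lintegral_map hφ (hp0.prodMk hY), hlaw, Measure.lintegral_compProd hφ,
    lintegral_map hφ.lintegral_kernel_prod_right' hp0]

/-- The version of `lintegral_eq_lintegral_condLaw` for events. -/
lemma measure_eq_lintegral_condLaw {Ω Ω' E : Type*} {m m0 : MeasurableSpace Ω}
    [MeasurableSpace Ω'] [MeasurableSpace E] {μ : Measure Ω} [IsProbabilityMeasure μ]
    (hm : m ≤ m0) {p : Ω → Ω'} (hp : Measurable[m] p) {Y : Ω → E} (hY : Measurable Y)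
    (κ : Kernel Ω' E) [IsMarkovKernel κ]
    (h : ∀ B : Set E, MeasurableSet B →
      μ[(Y ⁻¹' B).indicator (fun _ => (1 : ℝ)) | m] =ᵐ[μ] fun ω => (κ (p ω)).real B)
    {S : Set (Ω' × E)} (hS : MeasurableSet S) :
    μ ((fun ω => (p ω, Y ω)) ⁻¹' S) = ∫⁻ ω, κ (p ω) (Prod.mk (p ω) ⁻¹' S) ∂μ := by
  have hp0 : Measurable p := hp.mono hm le_rfl
  rw [← lintegral_indicator_one (hS.preimage (hp0.prodMk hY))]
  refine (lintegral_eq_lintegral_condLaw hm hp hY κ h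
    (measurable_one.indicator hS : Measurable (S.indicator (1 : Ω' × E → ENNReal)))).trans
    (lintegral_congr fun ω => ?_)
  rw [← lintegral_indicator_one (hS.preimage measurable_prodMk_left)]
  rfl

section Past

variable {d : ℕ} {Ω : Type*} {γ : ℝ} {g : ℕ → Ω → EuclideanSpace ℝ (Fin d)}

lemma measurable_pastSigma {s t : ℕ} (hs : s ∈ Finset.Ico 1 t) :
    Measurable[pastSigma g t] (g s) :=
  (comap_measurable (g s)).mono
    (le_iSup₂ (f := fun s (_ : s ∈ Finset.Ico 1 t) =>
      MeasurableSpace.comap (g s) inferInstance) s hs) le_rfl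

lemma measurable_adaAccum_pastSigma {s t : ℕ} (hst : s < t) :
    Measurable[pastSigma g t] (fun ω => adaAccum γ (fun s => g s ω) s) := by
  unfold adaAccum
  refine Measurable.const_add (Finset.measurable_sum _ fun r hr => ?_) _
  have := Finset.mem_Icc.1 hr
  have h := measurable_pastSigma (g := g) (t := t) (Finset.mem_Ico.2 (by omega : 1 ≤ r ∧ r < t))
  exact (measurable_norm.comp h).pow_const 2

end Past

namespace IsAdaSGDRun

variable {d : ℕ} {f : EuclideanSpace ℝ (Fin d) → ℝ} {β σ₀ σ₁ η γ : ℝ} {T : ℕ}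
  {κ : Kernel (EuclideanSpace ℝ (Fin d)) (EuclideanSpace ℝ (Fin d))}
  {w₁ : EuclideanSpace ℝ (Fin d)} {Ω : Type*} [MeasurableSpace Ω] {μ : Measure Ω}
  {w g : ℕ → Ω → EuclideanSpace ℝ (Fin d)}

lemma pastSigma_le (hrun : IsAdaSGDRun μ κ η γ T w₁ w g) {t : ℕ} (ht : t ≤ T + 1) :
    pastSigma g t ≤ ‹MeasurableSpace Ω› := by
  refine iSup₂_le fun s hs => ?_
  have := Finset.mem_Ico.1 hs
  exact (hrun.measurable s (Finset.mem_Icc.2 (by omega))).comap_le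

lemma measurable_iterate (hrun : IsAdaSGDRun μ κ η γ T w₁ w g) {s t : ℕ} (hs : 1 ≤ s) (hst : s ≤ t)
    (ht : t ≤ T + 1) : Measurable[pastSigma g t] (w s) := by
  induction s, hs using Nat.le_induction with
  | base =>
    rw [show w 1 = fun _ => w₁ from funext hrun.init]
    exact measurable_const
  | succ s hs ih =>
    have hg := measurable_pastSigma (g := g) (Finset.mem_Ico.2 (⟨hs, hst⟩ : 1 ≤ s ∧ s < t))
    have hA := measurable_adaAccum_pastSigma (γ := γ) (g := g) (t := t) (s := s) hst
    have e : w (s + 1) = fun ω => w s ω - (η / √(adaAccum γ (fun s => g s ω) s)) • g s ω :=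
      funext fun ω => hrun.step s (Finset.mem_Icc.2 (by omega)) ω
    rw [e]
    exact (ih (by omega)).sub ((hA.sqrt.const_div η).smul hg)

/-- The exponential supermartingale: predictable weights `u` against the noise. -/
lemma lintegral_exp_sum_le [IsProbabilityMeasure μ] (hrun : IsAdaSGDRun μ κ η γ T w₁ w g)
    (hf : IsBetaSmooth β f) (hκ : IsUnbiasedOracle f κ) (hsub : IsSubGaussianOracle σ₀ σ₁ κ)
    {u : ℕ → Ω → EuclideanSpace ℝ (Fin d)}
    (hu : ∀ t ∈ Finset.Icc 1 T, Measurable[pastSigma g t] (u t)) (t : ℕ) (ht : t ≤ T) :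
    Measurable[pastSigma g (t + 1)] (fun ω => ∑ s ∈ Finset.Icc 1 t,
      (inner ℝ (u s ω) (g s ω - gradient f (w s ω))
        - 4 * ‖u s ω‖ ^ 2 * noiseVar f σ₀ σ₁ (w s ω))) ∧
    ∫⁻ ω, ENNReal.ofReal (Real.exp (∑ s ∈ Finset.Icc 1 t,
      (inner ℝ (u s ω) (g s ω - gradient f (w s ω))
        - 4 * ‖u s ω‖ ^ 2 * noiseVar f σ₀ σ₁ (w s ω)))) ∂μ ≤ 1 := by
  have hgrad := hf.continuous_gradient.measurable
  have hvar : Measurable (noiseVar f σ₀ σ₁) := by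
    unfold noiseVar
    fun_prop
  have hmono : ∀ {s t : ℕ}, s ≤ t → pastSigma g s ≤ pastSigma g t := fun {s t} hst =>
    biSup_mono fun r hr => by
      have := Finset.mem_Ico.1 hr
      exact Finset.mem_Ico.2 (by omega)
  induction t with
  | zero => simp
  | succ t ih =>
    obtain ⟨ihm, ihi⟩ := ih (by omega)
    have hmem : t + 1 ∈ Finset.Icc 1 T := Finset.mem_Icc.2 ⟨by omega, ht⟩
    have hw := hrun.measurable_iterate (s := t + 1) (t := t + 1) (by omega) le_rfl (by omega)
    simp only [Finset.sum_Icc_succ_top (by omega : 1 ≤ t + 1)]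
    refine ⟨?_, ?_⟩
    · have h1 := (hmono (Nat.le_succ (t + 1)))
      have hu' := (hu _ hmem).mono h1 le_rfl
      have hw' := hw.mono h1 le_rfl
      have hg' := measurable_pastSigma (g := g) (s := t + 1) (t := t + 1 + 1)
        (Finset.mem_Ico.2 (by omega))
      refine (ihm.mono h1 le_rfl).add (((measurable_fst.inner measurable_snd).comp
        (hu'.prodMk (hg'.sub (hgrad.comp hw')))).sub ?_)
      exact (((measurable_norm.comp hu').pow_const 2).const_mul 4).mul (hvar.comp hw')
    · set S := fun ω => ∑ s ∈ Finset.Icc 1 t, (inner ℝ (u s ω) (g s ω - gradient f (w s ω))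
        - 4 * ‖u s ω‖ ^ 2 * noiseVar f σ₀ σ₁ (w s ω)) with hS
      have := hκ.markov
      let E := EuclideanSpace ℝ (Fin d)
      have hφ : Measurable fun q : (ℝ × E × E) × E => ENNReal.ofReal (Real.exp (q.1.1 +
          (inner ℝ q.1.2.1 (q.2 - gradient f q.1.2.2)
            - 4 * ‖q.1.2.1‖ ^ 2 * noiseVar f σ₀ σ₁ q.1.2.2))) := by fun_prop
      have key := lintegral_eq_lintegral_condLaw (μ := μ) (hrun.pastSigma_le (by omega))
        (p := fun ω => (S ω, u (t + 1) ω, w (t + 1) ω)) (ihm.prodMk ((hu _ hmem).prodMk hw))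
        (hrun.measurable _ hmem) (κ.comap (fun q : ℝ × E × E => q.2.2) (by fun_prop))
        (fun B hB => hrun.query _ hmem B hB) hφ
      refine key.le.trans (le_trans (lintegral_mono fun ω => ?_) ihi)
      simp only [Kernel.comap_apply, Real.exp_add, ENNReal.ofReal_mul (Real.exp_pos _).le]
      rw [lintegral_const_mul _ (by fun_prop)]
      exact mul_le_of_le_one_right' (hsub.lintegral_exp_inner_le hκ _ _)

/-- Markov's inequality for the exponential supermartingale. -/
lemma measure_sum_gt_le [IsProbabilityMeasure μ] (hrun : IsAdaSGDRun μ κ η γ T w₁ w g)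
    (hf : IsBetaSmooth β f) (hκ : IsUnbiasedOracle f κ) (hsub : IsSubGaussianOracle σ₀ σ₁ κ)
    {u : ℕ → Ω → EuclideanSpace ℝ (Fin d)}
    (hu : ∀ t ∈ Finset.Icc 1 T, Measurable[pastSigma g t] (u t)) {t : ℕ} (ht : t ≤ T) (x : ℝ) :
    μ {ω | x < ∑ s ∈ Finset.Icc 1 t, (inner ℝ (u s ω) (g s ω - gradient f (w s ω))
        - 4 * ‖u s ω‖ ^ 2 * noiseVar f σ₀ σ₁ (w s ω))} ≤ ENNReal.ofReal (Real.exp (-x)) := by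
  obtain ⟨hm, hi⟩ := hrun.lintegral_exp_sum_le hf hκ hsub hu t ht
  have hm' := (hm.mono (hrun.pastSigma_le (by omega)) le_rfl).exp.ennreal_ofReal
  have h := meas_ge_le_lintegral_div (μ := μ) hm'.aemeasurable
    (ε := ENNReal.ofReal (Real.exp x)) (by simp [Real.exp_pos]) ENNReal.ofReal_ne_top
  refine (measure_mono fun ω (hω : x < _) => ?_).trans (h.trans ?_)
  · exact ENNReal.ofReal_le_ofReal (Real.exp_le_exp.2 hω.le)
  · rw [Real.exp_neg, ENNReal.ofReal_inv_of_pos (Real.exp_pos x), ← one_div]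
    gcongr

lemma measure_noise_gt_le [IsProbabilityMeasure μ] (hrun : IsAdaSGDRun μ κ η γ T w₁ w g)
    (hf : IsBetaSmooth β f) (hκ : IsUnbiasedOracle f κ) (hsub : IsSubGaussianOracle σ₀ σ₁ κ)
    {ℓ : ℝ} (hℓ : 0 < ℓ) {t : ℕ} (ht : t ∈ Finset.Icc 1 T) :
    μ {ω | ℓ * noiseVar f σ₀ σ₁ (w t ω) < ‖g t ω - gradient f (w t ω)‖ ^ 2} ≤
      ENNReal.ofReal (2 * Real.exp (-ℓ)) := by
  have hgrad := hf.continuous_gradient.measurable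
  have hvar : Measurable (noiseVar f σ₀ σ₁) := by
    unfold noiseVar
    fun_prop
  have := hκ.markov
  have ht' := Finset.mem_Icc.1 ht
  have hw := hrun.measurable_iterate (s := t) (t := t) (by omega) le_rfl (by omega)
  have hset : MeasurableSet {q : EuclideanSpace ℝ (Fin d) × EuclideanSpace ℝ (Fin d) |
      ℓ * noiseVar f σ₀ σ₁ q.1 < ‖q.2 - gradient f q.1‖ ^ 2} :=
    measurableSet_lt (by fun_prop) (by fun_prop)
  have key := measure_eq_lintegral_condLaw (μ := μ) (hrun.pastSigma_le (by omega)) hw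
    (hrun.measurable _ ht) κ (fun B hB => hrun.query _ ht B hB) hset
  refine key.le.trans ((lintegral_mono fun ω => hsub.measure_noise_le hκ (w t ω) hℓ).trans ?_)
  simp

end IsAdaSGDRun

/-! ### The bounds on a good trajectory -/

section Path

variable {d : ℕ} {f : EuclideanSpace ℝ (Fin d) → ℝ} {β σ₀ σ₁ η γ δ fstar F : ℝ} {T : ℕ}
  {w g : ℕ → EuclideanSpace ℝ (Fin d)}

lemma sum_sq_div_adaAccum_le_boundC₁ (hf : IsBetaSmooth β f) (hβ : 0 ≤ β) (hη : 0 ≤ η)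
    (hγ : 0 < γ) (hℓ : 0 ≤ Real.log (4 * T / δ)) (hmin : ∀ z, fstar ≤ f z)
    (hstep : ∀ t ∈ Finset.Icc 1 T, w (t + 1) = w t - adaStep η γ g t • g t)
    (hnoise : ∀ s ∈ Finset.Icc 1 T,
      ‖g s - gradient f (w s)‖ ^ 2 ≤ Real.log (4 * T / δ) * noiseVar f σ₀ σ₁ (w s))
    {t : ℕ} (ht : t ≤ T) :
    ∑ s ∈ Finset.Icc 1 t, ‖g s‖ ^ 2 / adaAccum γ g s ≤
      Real.log 2 * boundC₁ β σ₀ σ₁ η γ δ (f (w 1) - fstar) T := by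
  have hA := adaAccum_le hf hβ hη hℓ hmin hstep hnoise
  have hΔ := sub_nonneg.2 (hmin (w 1))
  have h1 : ∑ s ∈ Finset.Icc 1 t, ‖g s‖ ^ 2 / adaAccum γ g s ≤
      ∑ s ∈ Finset.Icc 1 T, ‖g s‖ ^ 2 / adaAccum γ g s :=
    Finset.sum_le_sum_of_subset_of_nonneg (Finset.Icc_subset_Icc_right ht)
      fun s _ _ => div_nonneg (sq_nonneg _) (adaAccum_pos hγ s).le
  refine h1.trans ((sum_sq_div_adaAccum_le_log hγ T).trans ?_)
  rw [boundC₁, Real.logb, mul_div_cancel₀ _ (Real.log_pos one_lt_two).ne']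
  refine Real.log_le_log (div_pos (adaAccum_pos hγ T) (by positivity)) ?_
  set ℓ := Real.log (4 * T / δ)
  set P := η ^ 2 * β ^ 2 * (T : ℝ) ^ 3 + β * (f (w 1) - fstar) * T with hP
  have hP0 : 0 ≤ P := by positivity
  have h2 : 0 ≤ ℓ * σ₀ ^ 2 * T := by positivity
  have h3 : 0 ≤ ℓ * σ₁ ^ 2 * P := by positivity
  rw [div_le_iff₀ (by positivity), add_mul, div_mul_cancel₀ _ (by positivity)]
  linarith

lemma norm_gradient_sq_le_of_gap_le (hf : IsBetaSmooth β f) (hβ : 0 ≤ β)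
    (hmin : ∀ z, fstar ≤ f z) {z : EuclideanSpace ℝ (Fin d)} (hz : f z - fstar ≤ F) :
    ‖gradient f z‖ ^ 2 ≤ 2 * β * F :=
  (hf.norm_gradient_sq_le hβ hmin z).trans (mul_le_mul_of_nonneg_left hz (by positivity))

/-- Passage from the bound on the sum of squared gradients to the average, in terms of the
base-2 logarithms `L = log (T / δ)` and `L' = log (1 / δ)`. -/
lemma average_le_of_sum_le {D L L' ℓ x B G S T : ℝ} (hD0 : 0 ≤ D) (hσ₀ : 0 ≤ σ₀) (hL' : 1 ≤ L')
    (hL : L' ≤ L) (hT' : 1 ≤ T) (hℓL : ℓ ≤ 3 * L) (hx0 : 0 ≤ x) (hx : x ≤ 2 * L')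
    (hB : 0 ≤ B) (hbF : B ≤ D ^ 2) (t6 : 0 ≤ G)
    (hS : S ≤ 2 * G + 8 * D ^ 2 + 8 * ℓ * σ₁ ^ 2 * D ^ 2
        + 2 * D * (σ₀ * √(2 * ℓ * T)) + 32 * (σ₀ ^ 2 + σ₁ ^ 2 * B) * x) :
    1 / T * S ≤ 5 * D * (σ₀ * √L / √T)
        + 100 * (G + (1 + σ₁ ^ 2 * L' * L) * D ^ 2 + σ₀ ^ 2 * L' * L) * (1 / T) := by
  have hsq : √(2 * ℓ * T) ≤ 5 / 2 * (√L * √T) := by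
    rw [Real.sqrt_le_iff]
    refine ⟨by positivity, ?_⟩
    rw [mul_pow, mul_pow, Real.sq_sqrt (by linarith), Real.sq_sqrt (by linarith)]
    have : ℓ * T ≤ 3 * L * T := by gcongr
    nlinarith [mul_nonneg (by linarith : 0 ≤ L) (by linarith : 0 ≤ T)]
  have hLL : L ≤ L' * L := le_mul_of_one_le_left (by linarith) hL'
  have hLL' : L' ≤ L' * L := le_mul_of_one_le_right (by linarith) (by linarith)
  have t1 : 8 * ℓ * σ₁ ^ 2 * D ^ 2 ≤ 24 * (L' * L) * (σ₁ ^ 2 * D ^ 2) := by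
    have := mul_le_mul_of_nonneg_right (hℓL.trans (by linarith : 3 * L ≤ 3 * (L' * L)))
      (by positivity : 0 ≤ σ₁ ^ 2 * D ^ 2)
    linarith
  have t2 : 2 * D * (σ₀ * √(2 * ℓ * T)) ≤ 5 * D * σ₀ * (√L * √T) := by
    have := mul_le_mul_of_nonneg_left hsq (by positivity : 0 ≤ 2 * D * σ₀)
    linarith
  have t3 : 32 * (σ₀ ^ 2 + σ₁ ^ 2 * B) * x ≤
      64 * (L' * L) * (σ₀ ^ 2 + σ₁ ^ 2 * D ^ 2) := by
    have h1 : σ₀ ^ 2 + σ₁ ^ 2 * B ≤ σ₀ ^ 2 + σ₁ ^ 2 * D ^ 2 := by gcongr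
    have h2 := mul_le_mul h1 (hx.trans (by linarith : 2 * L' ≤ 2 * (L' * L)))
      hx0 (by positivity)
    linarith
  have hLL0 : 0 ≤ L' * L := by linarith
  have t4 : 0 ≤ (L' * L) * (σ₁ ^ 2 * D ^ 2) := by positivity
  have t5 : 0 ≤ (L' * L) * σ₀ ^ 2 := by positivity
  have t7 : 0 ≤ D ^ 2 := sq_nonneg D
  have hfin : S ≤ 5 * D * σ₀ * (√L * √T)
      + 100 * (G + (1 + σ₁ ^ 2 * L' * L) * D ^ 2 + σ₀ ^ 2 * L' * L) := by linarith
  have h0 : 0 < T := by linarith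
  have h8 := mul_le_mul_of_nonneg_left hfin (by positivity : 0 ≤ 1 / T)
  refine h8.trans (le_of_eq ?_)
  have e : √T / T = 1 / √T := by
    rw [div_eq_div_iff h0.ne' (Real.sqrt_pos.2 h0).ne', Real.mul_self_sqrt h0.le, one_mul]
  calc _ = 5 * D * σ₀ * √L * (√T / T) + 100 * (G + (1 + σ₁ ^ 2 * L' * L) * D ^ 2
        + σ₀ ^ 2 * L' * L) * (1 / T) := by ring
    _ = _ := by
      rw [e]
      ring

/-- Both the average bound and the gap bound hold on every trajectory whose noise obeys its
high-probability bound and along which both martingales are small. -/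
lemma bounds_of_good_trajectory (hf : IsBetaSmooth β f) (hβ : 0 ≤ β) (hη : 0 < η) (hγ : 0 < γ)
    (hσ₀ : 0 ≤ σ₀) (hσ₁ : 0 ≤ σ₁) (hmin : ∀ z, fstar ≤ f z) (hT : 1 ≤ T) (hδ : 0 < δ)
    (hδ3 : δ < 1 / 3) (hF : F = boundF β σ₀ σ₁ η γ δ (f (w 1) - fstar) T)
    (hstep : ∀ t ∈ Finset.Icc 1 T, w (t + 1) = w t - adaStep η γ g t • g t)
    (hnoise : ∀ s ∈ Finset.Icc 1 T,
      ‖g s - gradient f (w s)‖ ^ 2 ≤ Real.log (4 * T / δ) * noiseVar f σ₀ σ₁ (w s))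
    (hgapMart : ∀ t ∈ Finset.Icc 1 T, ∑ s ∈ Finset.Icc 1 t,
      (inner ℝ (gapWeight f σ₀ σ₁ η γ (Real.log (4 * T / δ)) fstar F
          (1 / (8 * η * (σ₀ + σ₁ * √(2 * β * F)))) w g s) (g s - gradient f (w s))
        - 4 * ‖gapWeight f σ₀ σ₁ η γ (Real.log (4 * T / δ)) fstar F
          (1 / (8 * η * (σ₀ + σ₁ * √(2 * β * F)))) w g s‖ ^ 2
          * noiseVar f σ₀ σ₁ (w s)) ≤ Real.log (T / δ))
    (havgMart : ∑ s ∈ Finset.Icc 1 T,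
      (inner ℝ (avgWeight f fstar F (1 / (16 * (σ₀ ^ 2 + σ₁ ^ 2 * (2 * β * F)))) w s)
          (g s - gradient f (w s))
        - 4 * ‖avgWeight f fstar F (1 / (16 * (σ₀ ^ 2 + σ₁ ^ 2 * (2 * β * F)))) w s‖ ^ 2
          * noiseVar f σ₀ σ₁ (w s)) ≤ Real.log (2 / δ)) :
    (1 / (T : ℝ) * ∑ t ∈ Finset.Icc 1 T, ‖gradient f (w t)‖ ^ 2 ≤
      5 * (2 * F / η + η * β) * (σ₀ * √(Real.logb 2 (T / δ)) / √T)
        + 100 * (γ / η * (f (w 1) - fstar)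
            + (1 + σ₁ ^ 2 * Real.logb 2 (1 / δ) * Real.logb 2 (T / δ)) * (2 * F / η + η * β) ^ 2
            + σ₀ ^ 2 * Real.logb 2 (1 / δ) * Real.logb 2 (T / δ)) * (1 / (T : ℝ)))
      ∧ ∀ t ∈ Finset.Icc 1 (T + 1), f (w t) - fstar ≤ F := by
  have hT' : (1 : ℝ) ≤ T := by exact_mod_cast hT
  have hΔ := sub_nonneg.2 (hmin (w 1))
  have hℓ := two_le_log_four_mul_div hT hδ hδ3
  have h1δ : 3 ≤ 1 / δ := by
    rw [le_div_iff₀ hδ]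
    linarith
  have hTδ : 1 / δ ≤ T / δ := by gcongr
  have hln := Real.log_two_lt_d9
  have hln0 := Real.log_pos one_lt_two
  have hlog : ∀ y, Real.log y = Real.log 2 * Real.logb 2 y := fun y => by
    rw [Real.logb]
    field_simp
  have hL' : 1 ≤ Real.logb 2 (1 / δ) := by
    rw [Real.le_logb_iff_rpow_le one_lt_two (by linarith), Real.rpow_one]
    linarith
  have hL : Real.logb 2 (1 / δ) ≤ Real.logb 2 (T / δ) :=
    Real.logb_le_logb_of_le one_lt_two (by linarith) hTδ
  have hF0 : 0 ≤ F := hF ▸ boundF_nonneg hη hγ hβ hσ₀ hΔ (by linarith) (by linarith)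
  have hgap : ∀ t ∈ Finset.Icc 1 (T + 1), f (w t) - fstar ≤ F := by
    refine gap_le_of_martingale_le (x := Real.log (T / δ)) hf hβ hη hγ (by linarith) hstep hnoise
      (fun t ht => sum_sq_div_adaAccum_le_boundC₁ hf hβ hη.le hγ (by linarith) hmin hstep hnoise ht)
      (Real.log_nonneg (by linarith)) (by positivity) (fun z hz => ?_) hgapMart
      (boundF_closes hη hγ hβ hσ₀ hσ₁ hΔ hT hδ hδ3 hF rfl rfl)
    have h1 := norm_gradient_sq_le_of_gap_le hf hβ hmin hz
    have h2 := Real.sq_sqrt (by positivity : 0 ≤ 2 * β * F)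
    have h3 := mul_le_mul_of_nonneg_left h1 (sq_nonneg σ₁)
    have h4 : 0 ≤ σ₀ * (σ₁ * √(2 * β * F)) := by positivity
    unfold noiseVar
    nlinarith
  refine ⟨?_, hgap⟩
  set D := 2 * F / η + η * β with hD
  have hD0 : 0 ≤ D := by positivity
  have hS := sum_sq_gradient_le (D := D) hf hβ hη hγ (by linarith) hσ₀ hσ₁ hmin hstep hnoise hgap
    (Real.log_nonneg (by rw [le_div_iff₀ hδ]; linarith)) (by positivity) (fun z hz => by
      have h1 := norm_gradient_sq_le_of_gap_le hf hβ hmin hz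
      have h3 := mul_le_mul_of_nonneg_left h1 (sq_nonneg σ₁)
      unfold noiseVar
      linarith) havgMart (by positivity) (by rw [hD]; gcongr; linarith)
  have hbF : 2 * β * F ≤ D ^ 2 := by
    have e : D ^ 2 = (2 * F / η - η * β) ^ 2 + 8 * (β * F) := by
      rw [hD]
      field_simp
      ring
    have : 0 ≤ β * F := by positivity
    nlinarith [sq_nonneg (2 * F / η - η * β)]
  have hx : Real.log (2 / δ) ≤ 2 * Real.logb 2 (1 / δ) := by
    have e : (2 : ℝ) / δ = 2 * (1 / δ) := by ring
    rw [e, Real.log_mul two_ne_zero (by positivity), hlog (1 / δ)]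
    nlinarith
  have hℓL : Real.log (4 * T / δ) ≤ 3 * Real.logb 2 (T / δ) := by
    have e : (4 : ℝ) * T / δ = 2 * (2 * (T / δ)) := by ring
    have hne : (T : ℝ) / δ ≠ 0 := by positivity
    rw [e, Real.log_mul two_ne_zero (by positivity), Real.log_mul two_ne_zero hne, hlog (T / δ)]
    nlinarith
  exact average_le_of_sum_le hD0 hσ₀ hL' hL hT' hℓL
    (Real.log_nonneg (by rw [le_div_iff₀ hδ]; linarith)) hx (by positivity) hbF (by positivity) hS

end Path

/-! ### Predictability of the weights and the probability of the good event -/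

namespace IsAdaSGDRun

variable {d : ℕ} {f : EuclideanSpace ℝ (Fin d) → ℝ} {β σ₀ σ₁ η γ : ℝ} {T : ℕ}
  {κ : Kernel (EuclideanSpace ℝ (Fin d)) (EuclideanSpace ℝ (Fin d))}
  {w₁ : EuclideanSpace ℝ (Fin d)} {Ω : Type*} [MeasurableSpace Ω] {μ : Measure Ω}
  {w g : ℕ → Ω → EuclideanSpace ℝ (Fin d)}

lemma measurable_avgWeight (hrun : IsAdaSGDRun μ κ η γ T w₁ w g) (hf : IsBetaSmooth β f)
    (fstar F c : ℝ) {t : ℕ} (ht : t ∈ Finset.Icc 1 T) :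
    Measurable[pastSigma g t] fun ω => avgWeight f fstar F c (fun s => w s ω) t := by
  have ht' := Finset.mem_Icc.1 ht
  have hw := hrun.measurable_iterate (s := t) (t := t) (by omega) le_rfl (by omega)
  have hgrad := hf.continuous_gradient.measurable
  have hfm := hf.differentiable.continuous.measurable
  have h : Measurable fun x : EuclideanSpace ℝ (Fin d) =>
      if f x - fstar ≤ F then (-c) • gradient f x else 0 :=
    Measurable.ite (measurableSet_le (by fun_prop) (by fun_prop)) (by fun_prop) measurable_const
  exact h.comp hw

lemma measurable_gapWeight (hrun : IsAdaSGDRun μ κ η γ T w₁ w g) (hf : IsBetaSmooth β f)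
    (ℓ fstar F c : ℝ) {t : ℕ} (ht : t ∈ Finset.Icc 1 T) :
    Measurable[pastSigma g t] fun ω =>
      gapWeight f σ₀ σ₁ η γ ℓ fstar F c (fun s => w s ω) (fun s => g s ω) t := by
  have ht' := Finset.mem_Icc.1 ht
  have hw := hrun.measurable_iterate (s := t) (t := t) (by omega) le_rfl (by omega)
  have hA := measurable_adaAccum_pastSigma (γ := γ) (g := g) (t := t) (s := t - 1) (by omega)
  have hgrad := hf.continuous_gradient.measurable
  have hfm := hf.differentiable.continuous.measurable
  have hvar : Measurable (noiseVar f σ₀ σ₁) := by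
    unfold noiseVar
    fun_prop
  have h : Measurable fun q : ℝ × EuclideanSpace ℝ (Fin d) =>
      if f q.2 - fstar ≤ F then
        (-(c * (η / √(q.1 + ‖gradient f q.2‖ ^ 2 + ℓ * noiseVar f σ₀ σ₁ q.2)))) • gradient f q.2
      else 0 :=
    Measurable.ite (measurableSet_le (by fun_prop) (by fun_prop)) (by fun_prop) measurable_const
  exact h.comp (hA.prodMk hw)

end IsAdaSGDRun

theorem theorem3 :
    ∃ c₁ : ℝ, 0 < c₁ ∧ ∃ c₂ : ℝ, 0 < c₂ ∧
      ∀ (d : ℕ) (f : EuclideanSpace ℝ (Fin d) → ℝ) (fstar β σ₀ σ₁ η γ δ : ℝ) (T : ℕ)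
        (κ : Kernel (EuclideanSpace ℝ (Fin d)) (EuclideanSpace ℝ (Fin d)))
        (w₁ : EuclideanSpace ℝ (Fin d))
        (Ω : Type*) [MeasurableSpace Ω] (μ : Measure Ω) [IsProbabilityMeasure μ]
        (w g : ℕ → Ω → EuclideanSpace ℝ (Fin d)),
        0 ≤ β → IsBetaSmooth β f → IsLeast (Set.range f) fstar →
        0 ≤ σ₀ → 0 ≤ σ₁ → IsUnbiasedOracle f κ → IsSubGaussianOracle σ₀ σ₁ κ →
        0 < η → 0 < γ → 1 ≤ T → 0 < δ → δ < 1 / 3 →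
        IsAdaSGDRun μ κ η γ T w₁ w g →
        ∀ Δ₁ F : ℝ, Δ₁ = f w₁ - fstar → F = boundF β σ₀ σ₁ η γ δ Δ₁ T →
        1 - 2 * δ ≤ μ.real {ω |
          (1 / (T : ℝ) * ∑ t ∈ Finset.Icc 1 T, ‖gradient f (w t ω)‖ ^ 2 ≤
            c₁ * (2 * F / η + η * β) * (σ₀ * Real.sqrt (Real.logb 2 (T / δ)) / Real.sqrt T)
            + c₂ * (γ / η * Δ₁
                + (1 + σ₁ ^ 2 * Real.logb 2 (1 / δ) * Real.logb 2 (T / δ))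
                    * (2 * F / η + η * β) ^ 2
                + σ₀ ^ 2 * Real.logb 2 (1 / δ) * Real.logb 2 (T / δ)) * (1 / (T : ℝ)))
          ∧ ∀ t ∈ Finset.Icc 1 (T + 1), f (w t ω) - fstar ≤ F} := by
  refine ⟨5, by norm_num, 100, by norm_num, ?_⟩
  intro d f fstar β σ₀ σ₁ η γ δ T κ w₁ Ω _ μ _ w g hβ hf hleast hσ₀ hσ₁ hκ hsub hη hγ hT hδ hδ3
    hrun Δ₁ F hΔ hF
  have hmin : ∀ z, fstar ≤ f z := fun z => hleast.2 ⟨z, rfl⟩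
  have hT' : (0 : ℝ) < T := by exact_mod_cast hT
  have hℓ := two_le_log_four_mul_div hT hδ hδ3
  -- the three events that have to be avoided, of probability at most `δ / 2`, `δ` and `δ / 2`
  set noiseBad : Set Ω := ⋃ t ∈ Finset.Icc 1 T, {ω | Real.log (4 * T / δ) *
    noiseVar f σ₀ σ₁ (w t ω) < ‖g t ω - gradient f (w t ω)‖ ^ 2} with hnoiseBad
  set u := fun t ω => gapWeight f σ₀ σ₁ η γ (Real.log (4 * T / δ)) fstar F
    (1 / (8 * η * (σ₀ + σ₁ * √(2 * β * F)))) (fun s => w s ω) (fun s => g s ω) t with hu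
  set u' := fun t ω => avgWeight f fstar F (1 / (16 * (σ₀ ^ 2 + σ₁ ^ 2 * (2 * β * F))))
    (fun s => w s ω) t with hu'
  set gapBad : Set Ω := ⋃ t ∈ Finset.Icc 1 T, {ω | Real.log (T / δ) < ∑ s ∈ Finset.Icc 1 t,
    (inner ℝ (u s ω) (g s ω - gradient f (w s ω))
      - 4 * ‖u s ω‖ ^ 2 * noiseVar f σ₀ σ₁ (w s ω))} with hgapBad
  set avgBad : Set Ω := {ω | Real.log (2 / δ) < ∑ s ∈ Finset.Icc 1 T,
    (inner ℝ (u' s ω) (g s ω - gradient f (w s ω))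
      - 4 * ‖u' s ω‖ ^ 2 * noiseVar f σ₀ σ₁ (w s ω))} with havgBad
  have hexp : ∀ y : ℝ, 0 < y → Real.exp (-Real.log y) = 1 / y := fun y hy => by
    rw [Real.exp_neg, Real.exp_log hy, one_div]
  have hunion : ∀ (A : ℕ → Set Ω) (p : ℝ), (∀ t ∈ Finset.Icc 1 T, μ (A t) ≤ ENNReal.ofReal p) →
      0 ≤ p → μ (⋃ t ∈ Finset.Icc 1 T, A t) ≤ ENNReal.ofReal (T * p) := by
    intro A p hA hp
    refine (measure_biUnion_finset_le _ _).trans ((Finset.sum_le_sum hA).trans (le_of_eq ?_))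
    rw [Finset.sum_const, Nat.card_Icc, Nat.add_sub_cancel, nsmul_eq_mul,
      ENNReal.ofReal_mul (Nat.cast_nonneg T), ENNReal.ofReal_natCast]
  have h1 : μ noiseBad ≤ ENNReal.ofReal (δ / 2) := by
    refine (hunion _ _ (fun t ht => hrun.measure_noise_gt_le hf hκ hsub (by linarith) ht)
      (by positivity)).trans (le_of_eq ?_)
    rw [hexp _ (by positivity)]
    congr 1
    field_simp
    norm_num
  have h2 : μ gapBad ≤ ENNReal.ofReal δ := by
    refine (hunion _ _ (fun t ht => hrun.measure_sum_gt_le hf hκ hsub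
      (fun t ht => hrun.measurable_gapWeight hf _ _ _ _ ht) (Finset.mem_Icc.1 ht).2 _)
      (by positivity)).trans (le_of_eq ?_)
    rw [hexp _ (by positivity)]
    congr 1
    field_simp
  have h3 : μ avgBad ≤ ENNReal.ofReal (δ / 2) := by
    refine (hrun.measure_sum_gt_le hf hκ hsub
      (fun t ht => hrun.measurable_avgWeight hf _ _ _ ht) le_rfl _).trans (le_of_eq ?_)
    rw [hexp _ (by positivity)]
    congr 1
    field_simp
  have hbad : μ.real (noiseBad ∪ gapBad ∪ avgBad) ≤ 2 * δ := by
    refine ENNReal.toReal_le_of_le_ofReal (by positivity) ?_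
    refine (measure_union_le _ _).trans ((add_le_add (measure_union_le _ _) h3).trans ?_)
    refine (add_le_add (add_le_add h1 h2) le_rfl).trans (le_of_eq ?_)
    rw [← ENNReal.ofReal_add (by positivity) hδ.le, ← ENNReal.ofReal_add (by positivity)
      (by positivity)]
    congr 1
    ring
  set good := {ω | (1 / (T : ℝ) * ∑ t ∈ Finset.Icc 1 T, ‖gradient f (w t ω)‖ ^ 2 ≤ _) ∧ _}
  have hcover : Set.univ ⊆ good ∪ (noiseBad ∪ gapBad ∪ avgBad) := by
    intro ω _
    by_cases hω : ω ∈ noiseBad ∪ gapBad ∪ avgBad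
    · exact Or.inr hω
    · left
      simp only [Set.mem_union, not_or, hnoiseBad, hgapBad, havgBad, Set.mem_iUnion,
        Set.mem_ofPred_eq, not_exists, not_lt] at hω
      obtain ⟨⟨hn, hg⟩, ha⟩ := hω
      have hΔ' : Δ₁ = f (w 1 ω) - fstar := by rw [hΔ, hrun.init]
      subst hΔ'
      exact bounds_of_good_trajectory (w := fun s => w s ω) (g := fun s => g s ω) hf hβ hη hγ
        hσ₀ hσ₁ hmin hT hδ hδ3 hF (fun t ht => hrun.step t ht ω) hn hg ha
  have h4 := measureReal_mono (μ := μ) hcover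
  have h5 := measureReal_union_le (μ := μ) good (noiseBad ∪ gapBad ∪ avgBad)
  rw [probReal_univ] at h4
  linarith
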